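/- Let $\ell\ge 2$ be an integer. Box $(x,y)$ (row $x$, column $y$, English notation) of a partition has residue $(y-x) \bmod \ell\in\{0,\dots,\ell-1\}$; an $\ell$-core is a partition none of whose hook lengths is divisible by $\ell$. Let $V=\{v=(v_0,\dots,v_{\ell-1})\in\mathbf R^\ell:\sum_j v_j=0\}$. For $1\le i\le \ell-1$ let $s_i:V\to V$ exchange the coordinates $v_{i-1}$ and $v_i$, and let $s_0(v)=(v_{\ell-1}+1,v_1,\dots,v_{\ell-2},v_0-1)$. The affine symmetric group $\widetilde{S_\ell}$ is the group of affine transformations of $V$ generated by $s_0,\dots,s_{\ell-1}$, $l$ is its Coxeter length (least length of a word in the $s_i$), and $S_\ell$ is the subgroup generated by $s_1,\dots,s_{\ell-1}$. The set $\{g\in\widetilde{S_\ell}: l(gs_i)>l(g)\text{ for }1\le i\le\ell-1\}$ contains exactly one element of each left coset $gS_\ell$, its minimal length representative. An abacus of a partition $\lambda$ with $r$ nonzero parts is a set of integers (beads) obtained by a common shift from the set of its $\beta$-numbers, namely the hook lengths of the first column of $\lambda$ together with $-1,-2,-3,\dots$. For each $\ell$-core $\lambda$ there is a unique $b=(b_0,\dots,b_{\ell-1})\in\mathbf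 Z^\ell$ with $\sum_j b_j=0$ such that the set $\{n\ell+j: 0\le j\le \ell-1,\ n\in\mathbf Z,\ n\le b_j\}$ is an abacus of $\lambda$. The minimal length coset representative indexed by $\lambda$ is the one of the coset $t_bS_\ell$, where $t_b$ is translation by $b$. With $b_{-1}=b_{\ell-1}$, call $s_i$ an ascent for $\lambda$ if $b_{i-1}>b_i-\delta_{i,0}$ and a descent if $b_{i-1}<b_i-\delta_{i,0}$. Applying $s_i$ to $\lambda$ adds all addable boxes of residue $i$ if $s_i$ is an ascent, removes all boxes of residue $i$ lying at the end of both their row and their column if $s_i$ is a descent, and does nothing otherwise. Define words recursively: $w(\emptyset)$ is the empty word, and $w(\lambda)=s_i\,w(\widehat\lambda)$ for $\lambda\neq\emptyset$, where $i$ is the residue of the rightmost box of the bottom row of $\lambda$ and $\widehat\lambda$ is the result of applying $s_i$ to $\lambda$. **Proposition.** For every $\ell$-core $\lambda$, the word $w(\lambda)$ is a reduced expression for the minimal length coset representative in $\widetilde{S_\ell}/S_\ell$ indexed by $\lambda$. Its Coxeter length is $$l(w(\lambda))=\sum_{i=0}^{\ell-1}\lambda_{R(i)},$$ where $R(i)$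 is the longest row of $\lambda$ whose rightmost box has residue $i$, and $\lambda_{R(i)}=0$ if there is no such row. -/

import Mathlib

namespace AffineCore

/-! ### Partitions, residues, cores

Partitions are Young diagrams in English notation; rows and columns are numbered from `0`,
so that contents `j - i`, hence residues, agree with the usual numbering from `1`. -/

/-- The residue modulo `ℓ` of the box in row `c.1` and column `c.2`: the least nonnegative integer
congruent to column minus row. -/
def residue (ℓ : ℕ) [NeZero ℓ] (c : ℕ × ℕ) : Fin ℓ :=
  ⟨(((c.2 : ℤ) - (c.1 : ℤ)) % (ℓ : ℤ)).toNat, by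
    have h0 : (ℓ : ℤ) ≠ 0 := by exact_mod_cast NeZero.ne ℓ
    have h1 := Int.emod_nonneg ((c.2 : ℤ) - (c.1 : ℤ)) h0
    have h3 : (0 : ℤ) < (ℓ : ℤ) := by exact_mod_cast Nat.pos_of_ne_zero (NeZero.ne ℓ)
    have h2 := Int.emod_lt_of_pos ((c.2 : ℤ) - (c.1 : ℤ)) h3
    omega⟩

/-- The hook length of the box `c`: the number of boxes of `μ` weakly to the right of `c` in its
row or weakly below `c` in its column. -/
def hookLength (μ : YoungDiagram) (c : ℕ × ℕ) : ℕ :=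
  (μ.cells.filter fun d => (d.1 = c.1 ∧ c.2 ≤ d.2) ∨ (d.2 = c.2 ∧ c.1 ≤ d.1)).card

/-- `ℓ`-cores: no hook length is divisible by `ℓ`. -/
def IsCore (ℓ : ℕ) (μ : YoungDiagram) : Prop :=
  ∀ c ∈ μ, ¬ ℓ ∣ hookLength μ c

/-- The last (rightmost) box of row `r`; meaningful when `r < μ.colLen 0`, the number of rows. -/
def lastBox (μ : YoungDiagram) (r : ℕ) : ℕ × ℕ := (r, μ.rowLen r - 1)

/-- The residue of the rightmost box of the bottom row (meaningful when `μ ≠ ⊥`). -/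
def bottomResidue (ℓ : ℕ) [NeZero ℓ] (μ : YoungDiagram) : Fin ℓ :=
  residue ℓ (lastBox μ (μ.colLen 0 - 1))

/-- The length of the longest row of `μ` whose rightmost box has residue `i`
(`0` if there is no such row). -/
def longestRowLen (ℓ : ℕ) [NeZero ℓ] (μ : YoungDiagram) (i : Fin ℓ) : ℕ :=
  ((Finset.range (μ.colLen 0)).filter fun r => residue ℓ (lastBox μ r) = i).sup μ.rowLen

/-! ### The affine symmetric group -/

/-- The space `V` of vectors of `ℝ^ℓ` with coordinate sum zero, i.e. the real span of the root
lattice. Coordinates are labelled `0, …, ℓ - 1`. -/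
def V (ℓ : ℕ) : Submodule ℝ (Fin ℓ → ℝ) where
  carrier := {v | ∑ j, v j = 0}
  add_mem' := by
    intro a b ha hb
    simp only [Set.mem_ofPred_eq] at ha hb ⊢
    simp [Finset.sum_add_distrib, ha, hb]
  zero_mem' := by simp
  smul_mem' := by
    intro c a ha
    simp only [Set.mem_ofPred_eq] at ha ⊢
    simp [← Finset.mul_sum, ha]

/-- Permutation of coordinates on `V`. -/
def permuteCoords {ℓ : ℕ} (σ : Equiv.Perm (Fin ℓ)) : V ℓ ≃ₗ[ℝ] V ℓ where
  toFun v := ⟨fun j => v.1 (σ j), by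
    have h : ∑ j, v.1 j = 0 := v.2
    change ∑ j, v.1 (σ j) = 0
    rw [Equiv.sum_comp σ v.1, h]⟩
  invFun v := ⟨fun j => v.1 (σ.symm j), by
    have h : ∑ j, v.1 j = 0 := v.2
    change ∑ j, v.1 (σ.symm j) = 0
    rw [Equiv.sum_comp σ.symm v.1, h]⟩
  map_add' v w := rfl
  map_smul' c v := rfl
  left_inv v := by ext j; simp
  right_inv v := by ext j; simp

/-- The highest root: first basis vector minus last basis vector
(`0 - 1` is `ℓ - 1` in `Fin ℓ`). -/
def theta (ℓ : ℕ) [NeZero ℓ] : V ℓ :=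
  ⟨Pi.single 0 1 - Pi.single (0 - 1) 1, by
    change ∑ j, _ = _
    simp [Finset.sum_sub_distrib]⟩

/-- The simple reflection `s_i`. For `i ≠ 0` it exchanges the coordinates `i - 1` and `i`;
`s_0` exchanges the coordinates `ℓ - 1` and `0`, then adds `1` to coordinate `0` and
subtracts `1` from coordinate `ℓ - 1`. (Subtraction in `Fin ℓ` is cyclic.) -/
noncomputable def simple {ℓ : ℕ} [NeZero ℓ] (i : Fin ℓ) : V ℓ ≃ᵃ[ℝ] V ℓ :=
  AffineEquiv.constVAdd ℝ (V ℓ) (if i = 0 then theta ℓ else 0) *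
    (permuteCoords (Equiv.swap (i - 1) i)).toAffineEquiv

/-- The affine symmetric group, as the group of affine transformations of `V` generated by
`s_0, …, s_{ℓ-1}`. -/
noncomputable def affineSymmetricGroup (ℓ : ℕ) [NeZero ℓ] : Subgroup (V ℓ ≃ᵃ[ℝ] V ℓ) :=
  Subgroup.closure (Set.range (simple (ℓ := ℓ)))

/-- The finite symmetric group, generated by `s_1, …, s_{ℓ-1}`. -/
noncomputable def finiteSymmetricGroup (ℓ : ℕ) [NeZero ℓ] : Subgroup (V ℓ ≃ᵃ[ℝ] V ℓ) :=
  Subgroup.closure (simple '' {i : Fin ℓ | i ≠ 0})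

/-- `s_i` as an element of the affine symmetric group. -/
noncomputable def simpleGen {ℓ : ℕ} [NeZero ℓ] (i : Fin ℓ) : affineSymmetricGroup ℓ :=
  ⟨simple i, Subgroup.subset_closure ⟨i, rfl⟩⟩

/-- The product `s_{i₁} s_{i₂} ⋯ s_{iₚ}` of a word `[i₁, …, iₚ]`. -/
noncomputable def wordProd {ℓ : ℕ} [NeZero ℓ] (ω : List (Fin ℓ)) : affineSymmetricGroup ℓ :=
  (ω.map simpleGen).prod

/-- Coxeter length: the least length of a word in the generators with product `g`. -/
noncomputable def coxeterLength {ℓ : ℕ} [NeZero ℓ] (g : affineSymmetricGroup ℓ) : ℕ :=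
  sInf {n | ∃ ω : List (Fin ℓ), ω.length = n ∧ wordProd ω = g}

/-- `ω` is a reduced expression for `g`. -/
def IsReducedExpression {ℓ : ℕ} [NeZero ℓ] (ω : List (Fin ℓ)) (g : affineSymmetricGroup ℓ) :
    Prop :=
  wordProd ω = g ∧ ω.length = coxeterLength g

/-- The parabolic quotient: the minimal length representatives of the left cosets of the finite
symmetric group. -/
def minimalRepresentatives (ℓ : ℕ) [NeZero ℓ] : Set (affineSymmetricGroup ℓ) :=
  {g | ∀ i : Fin ℓ, i ≠ 0 → coxeterLength g < coxeterLength (g * simpleGen i)}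

/-! ### The root lattice, abaci, and the indexing of cosets by cores -/

/-- The root lattice of type `A_{ℓ-1}`: integer vectors with coordinate sum zero. -/
def RootLattice (ℓ : ℕ) : Type := {b : Fin ℓ → ℤ // ∑ j, b j = 0}

/-- A root lattice vector as an element of `V`. -/
def RootLattice.toV {ℓ : ℕ} (b : RootLattice ℓ) : V ℓ :=
  ⟨fun j => (b.1 j : ℝ), by
    change ∑ j, (b.1 j : ℝ) = 0
    exact_mod_cast b.2⟩

/-- Translation by `b`. -/
def translation {ℓ : ℕ} (b : RootLattice ℓ) : V ℓ ≃ᵃ[ℝ] V ℓ :=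
  AffineEquiv.constVAdd ℝ (V ℓ) b.toV

/-- `g` is the minimal length representative of the left coset of the finite symmetric group that
contains the translation by `b`. -/
def IsMinimalRepresentativeAt {ℓ : ℕ} [NeZero ℓ] (b : RootLattice ℓ)
    (g : affineSymmetricGroup ℓ) : Prop :=
  g ∈ minimalRepresentatives ℓ ∧
    (translation b)⁻¹ * (g : V ℓ ≃ᵃ[ℝ] V ℓ) ∈ finiteSymmetricGroup ℓ

/-- The `β`-numbers of `μ`: the hook lengths of the first column, followed by
`-1, -2, -3, …`. -/
def betaNumber (μ : YoungDiagram) (r : ℕ) : ℤ :=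
  if r < μ.colLen 0 then (hookLength μ (r, 0) : ℤ) else (μ.colLen 0 : ℤ) - 1 - (r : ℤ)

/-- The set `S` of bead positions is an abacus of `μ`: it is the set of `β`-numbers up to a
common shift. -/
def IsAbacusOf (μ : YoungDiagram) (S : Set ℤ) : Prop :=
  ∃ c : ℤ, S = Set.range fun r => betaNumber μ r + c

/-- The balanced flush abacus with beads on runner `j` exactly at the levels `≤ b j`; the entry on
runner `j` and level `n` is `n * ℓ + j`. -/
def flushAbacus {ℓ : ℕ} (b : RootLattice ℓ) : Set ℤ :=
  {p | ∃ (j : Fin ℓ) (n : ℤ), n ≤ b.1 j ∧ p = n * (ℓ : ℤ) + ((j : ℕ) : ℤ)}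

/-- `μ` is the core attached to `b`: the balanced flush abacus given by `b` is an abacus
of `μ`. -/
def Corresponds {ℓ : ℕ} (b : RootLattice ℓ) (μ : YoungDiagram) : Prop :=
  IsAbacusOf μ (flushAbacus b)

/-- `g` is the minimal length coset representative indexed by `μ`. -/
def IsMinimalRepresentativeOf {ℓ : ℕ} [NeZero ℓ] (μ : YoungDiagram)
    (g : affineSymmetricGroup ℓ) : Prop :=
  ∃ b : RootLattice ℓ, Corresponds b μ ∧ IsMinimalRepresentativeAt b g

/-! ### The action of the simple reflections on cores -/

/-- `s_i` is a descent for `μ`. -/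
def IsDescent {ℓ : ℕ} [NeZero ℓ] (i : Fin ℓ) (μ : YoungDiagram) : Prop :=
  ∃ b : RootLattice ℓ, Corresponds b μ ∧ b.1 (i - 1) < b.1 i - (if i = 0 then 1 else 0)

/-- `s_i` is an ascent for `μ`. -/
def IsAscent {ℓ : ℕ} [NeZero ℓ] (i : Fin ℓ) (μ : YoungDiagram) : Prop :=
  ∃ b : RootLattice ℓ, Corresponds b μ ∧ b.1 i - (if i = 0 then 1 else 0) < b.1 (i - 1)

/-- A box at the end of both its row and its column. -/
def IsRemovable (μ : YoungDiagram) (c : ℕ × ℕ) : Prop :=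
  c ∈ μ ∧ (c.1, c.2 + 1) ∉ μ ∧ (c.1 + 1, c.2) ∉ μ

/-- A box outside `μ` whose addition gives a partition. -/
def IsAddable (μ : YoungDiagram) (c : ℕ × ℕ) : Prop :=
  c ∉ μ ∧ IsLowerSet (insert c (μ : Set (ℕ × ℕ)))

open Classical in
/-- Remove all removable boxes of residue `i`. -/
noncomputable def removeBoxes {ℓ : ℕ} [NeZero ℓ] (i : Fin ℓ) (μ : YoungDiagram) :
    YoungDiagram where
  cells := μ.cells.filter fun c => ¬ (IsRemovable μ c ∧ residue ℓ c = i)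
  isLowerSet := by
    intro c d hdc hc
    simp only [Finset.coe_filter, Set.mem_ofPred_eq, YoungDiagram.mem_cells] at hc ⊢
    obtain ⟨hcμ, hc2⟩ := hc
    refine ⟨μ.isLowerSet hdc hcμ, ?_⟩
    rintro ⟨⟨_, h1, h2⟩, h3⟩
    rcases eq_or_ne d c with rfl | hne
    · exact hc2 ⟨⟨hcμ, h1, h2⟩, h3⟩
    · obtain ⟨d1, d2⟩ := d
      obtain ⟨c1, c2⟩ := c
      obtain ⟨hle1, hle2⟩ := Prod.mk_le_mk.mp hdc
      rcases Nat.lt_or_ge d2 c2 with hlt | hge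
      · exact h1 (μ.isLowerSet (Prod.mk_le_mk.mpr ⟨hle1, hlt⟩) hcμ)
      · have h12 : d1 < c1 := by
          rcases Nat.lt_or_ge d1 c1 with h | h
          · exact h
          · exact absurd (Prod.ext (by simp; omega) (by simp; omega)) hne
        exact h2 (μ.isLowerSet (Prod.mk_le_mk.mpr ⟨h12, hle2⟩) hcμ)

open Classical in
/-- Add all addable boxes of residue `i`. (Every addable box lies in row at most `μ.colLen 0` and
column at most `μ.rowLen 0`.) -/
noncomputable def addBoxes {ℓ : ℕ} [NeZero ℓ] (i : Fin ℓ) (μ : YoungDiagram) :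
    YoungDiagram where
  cells := μ.cells ∪
    (Finset.range (μ.colLen 0 + 1) ×ˢ Finset.range (μ.rowLen 0 + 1)).filter
      fun c => IsAddable μ c ∧ residue ℓ c = i
  isLowerSet := by
    intro c d hdc hc
    rw [Finset.mem_coe, Finset.mem_union] at hc ⊢
    rcases hc with hc | hc
    · exact Or.inl (μ.isLowerSet hdc hc)
    · have hadd := (Finset.mem_filter.mp hc).2.1
      have hd : d ∈ insert c (μ : Set (ℕ × ℕ)) := hadd.2 hdc (Set.mem_insert c _)
      rcases hd with rfl | hd
      · exact Or.inr hc
      · exact Or.inl hd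

open Classical in
/-- The result of applying `s_i` to the core `μ`. -/
noncomputable def applySimple {ℓ : ℕ} [NeZero ℓ] (i : Fin ℓ) (μ : YoungDiagram) :
    YoungDiagram :=
  if IsAscent i μ then addBoxes i μ
  else if IsDescent i μ then removeBoxes i μ
  else μ

/-! ### The canonical word -/

open Classical in
/-- The word `w(μ)`: empty for the empty partition, and otherwise `s_i` followed by the word of
`s_i μ`, where `i` is the residue of the rightmost box of the bottom row of `μ`. The test that
`s_i μ` has fewer boxes than `μ` only makes the recursion well-founded on arbitrary diagrams:
it succeeds for every nonempty core, where `s_i` is a descent. -/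
noncomputable def canonicalWord (ℓ : ℕ) [NeZero ℓ] (μ : YoungDiagram) : List (Fin ℓ) :=
  if μ = ⊥ then []
  else if (applySimple (bottomResidue ℓ μ) μ).card < μ.card then
    bottomResidue ℓ μ :: canonicalWord ℓ (applySimple (bottomResidue ℓ μ) μ)
  else []
termination_by μ.card

end AffineCore

/-!
Write `x = g p`, where `p` is a point of the fundamental alcove
`v₀ > v₁ > ⋯ > v_{ℓ-1} > v₀ - 1`. The Coxeter length of `g` is the number of affine root
hyperplanes separating `p` from `x` (`coxeterLength_eq_inversionCount`): left multiplication by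
`s_i` changes this number by one, upwards exactly when `x_{i-1} > x_i - δ_{i,0}`, and a `g`
without descents fixes the alcove, hence is `1`.

The point `x` differs from the lattice point `b = g 0` by a permutation of `p`, and coordinates of
`p` differ by less than `1`. So whenever the integers `b_{i-1}` and `b_i - δ_{i,0}` differ, the sign
of the change depends only on `b`, that is, only on the coset of `g`. Along the canonical word every
letter is such a strict ascent. Consequently `l(w(μ) u) = |w(μ)| + l(u)` for every `u` in the finite
group (`canonicalWord_spec`), which makes `w(μ)` reduced and its product the only minimal length
representative of the coset (`isMinimalRepresentativeOf_iff`).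

On the side of partitions, a row of length `λ_r` becomes a bead at `λ_r - r + ℓ - 1`, and hook
lengths are differences between a bead and a smaller gap; so cores have flush abaci
(`IsCore.exists_corresponds`). The shift `ℓ - 1` is forced by `∑ b_j = 0`, and with it the runner of
a bead is the residue of the last box of its row. The bead of the bottom row is the first one after
a gap, so its residue is a descent, and removing boxes there swaps two neighbouring runners, which
is the action of `s_i` on `b` (`corresponds_removeBoxes`). Finally, `λ_{R(i)}` is the number of gaps
below the last bead on runner `i`; summed over `i` this is a function of `b`
(`sum_longestRowLen`) which drops by one at each descent (`latticeLength_reflect`).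

Both length functions are sums of positive parts of integer matrices which `s_i` transforms in the
same way, and `positiveSum_step` handles them together.
-/

namespace AffineCore

variable {ℓ : ℕ} [NeZero ℓ]

/-! ### The simple reflections in coordinates -/


/-- The integer shift of coordinate `j` performed by `s_i`. -/
def shift (i j : Fin ℓ) : ℤ :=
  if i = 0 then (if j = 0 then 1 else 0) - (if j = 0 - 1 then 1 else 0) else 0

/-- The offset `δ_{i,0}`. -/
def offset (i : Fin ℓ) : ℤ := if i = 0 then 1 else 0

theorem val_sub_one (i : Fin ℓ) :
    ((i - 1 : Fin ℓ) : ℕ) = if i = 0 then ℓ - 1 else (i : ℕ) - 1 := by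
  have hpos := Nat.pos_of_ne_zero (NeZero.ne ℓ)
  obtain ⟨n, rfl⟩ : ∃ n, ℓ = n + 1 := ⟨ℓ - 1, by omega⟩
  simpa using Fin.coe_sub_one i

theorem sub_one_ne (hℓ : 2 ≤ ℓ) (i : Fin ℓ) : i - 1 ≠ i := by
  intro h
  have h1 := congrArg Fin.val h
  rw [val_sub_one] at h1
  split_ifs at h1 with h0
  · subst h0
    simp at h1
    omega
  · have : (i : ℕ) ≠ 0 := fun h => h0 (Fin.ext (by simpa using h))
    omega

theorem shift_self (hℓ : 2 ≤ ℓ) (i : Fin ℓ) : shift i i = offset i := by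
  unfold shift offset
  split_ifs with h0 h1
  · subst h0
    exact absurd h1.symm (sub_one_ne hℓ 0)
  · simp
  · rfl

theorem shift_sub_one (hℓ : 2 ≤ ℓ) (i : Fin ℓ) : shift i (i - 1) = -offset i := by
  unfold shift offset
  by_cases h0 : i = 0
  · subst h0
    simp [show ℓ ≠ 1 by omega]
  · simp [h0]

theorem simple_apply (i : Fin ℓ) (v : V ℓ) (j : Fin ℓ) :
    (simple i v).1 j = v.1 (Equiv.swap (i - 1) i j) + (shift i j : ℝ) := by
  have h : (simple i v).1 j = (if i = 0 then theta ℓ else 0 : V ℓ).1 j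
      + v.1 (Equiv.swap (i - 1) i j) := by
    rfl
  rw [h, add_comm]
  congr 1
  unfold shift
  by_cases h0 : i = 0
  · simp only [h0, if_true]
    simp only [theta, Pi.sub_apply, Pi.single_apply]
    push_cast
    rfl
  · simp [h0]

theorem simple_mul_self (i : Fin ℓ) : simple i * simple i = 1 := by
  ext v j
  change (simple i (simple i v)).1 j = v.1 j
  rw [simple_apply, simple_apply, Equiv.swap_apply_self]
  have h : shift i (Equiv.swap (i - 1) i j) + shift i j = 0 := by
    unfold shift
    by_cases h0 : i = 0
    · subst h0
      rw [Equiv.swap_apply_def]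
      grind
    · simp [h0]
  have h' : ((shift i (Equiv.swap (i - 1) i j) : ℤ) : ℝ) + (shift i j : ℤ) = 0 := by
    exact_mod_cast h
  linarith

theorem simpleGen_mul_self (i : Fin ℓ) : simpleGen i * simpleGen i = 1 :=
  Subtype.ext (simple_mul_self i)

/-- The map `s_i` preserves the order of indices, corrected by `shift i`, except on the pair
`{i - 1, i}`. For `i = 0` the correction compensates for moving index `ℓ - 1` to the front. -/
theorem shift_add_lt (hℓ : 2 ≤ ℓ) (i j k : Fin ℓ) :
    shift i j - shift i k + (if k < j then 1 else 0) =
      (if Equiv.swap (i - 1) i k < Equiv.swap (i - 1) i j then 1 else 0)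
        + (if j = i ∧ k = i - 1 then 1 else 0) - (if j = i - 1 ∧ k = i then 1 else 0) := by
  have hne := sub_one_ne hℓ i
  have hv := val_sub_one i
  have hv0 := val_sub_one (0 : Fin ℓ)
  have hj := j.isLt
  have hk := k.isLt
  have hi := i.isLt
  simp only [if_true] at hv0
  unfold shift
  by_cases h0 : i = 0
  · subst h0
    simp only [Equiv.swap_apply_def, Fin.lt_def, Fin.ext_iff, apply_ite Fin.val, hv0,
      Fin.val_zero, if_true]
    split_ifs <;> omega
  · simp only [h0, if_false] at hv ⊢
    have : (i : ℕ) ≠ 0 := fun h => h0 (Fin.ext (by simpa using h))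
    simp only [Equiv.swap_apply_def, Fin.lt_def, Fin.ext_iff, apply_ite Fin.val, hv]
    split_ifs <;> omega

/-! ### A statistic that changes by one under a simple reflection -/

/-- The sum of the positive parts of the entries of an integer matrix. -/
def positiveSum (E : Fin ℓ → Fin ℓ → ℤ) : ℕ := ∑ j, ∑ k, (E j k).toNat

/-- If `D` behaves like a matrix of rounded coordinate differences of a vector and `D'` like that
of its image under `s_i`, then the correction by `k < j` turns the transformation into a relabelling
of entries, except at the two entries of the pair `{i - 1, i}`. The hypotheses say that the vector
lies on the positive side of the hyperplane of `s_i`; then one of the two entries grows by one and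
the other one contributes `0` before and after. -/
theorem positiveSum_step (hℓ : 2 ≤ ℓ) (i : Fin ℓ) {D D' : Fin ℓ → Fin ℓ → ℤ}
    (hD : ∀ j k, D' j k =
      D (Equiv.swap (i - 1) i j) (Equiv.swap (i - 1) i k) + (shift i j - shift i k))
    (h1 : 0 ≤ D (i - 1) i + offset i) (h2 : D i (i - 1) - offset i + 1 ≤ 0) :
    positiveSum (fun j k => D' j k + if k < j then 1 else 0) =
      positiveSum (fun j k => D j k + if k < j then 1 else 0) + 1 := by
  have hne := sub_one_ne hℓ i
  set σ := Equiv.swap (i - 1) i with hσ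
  set E : Fin ℓ → Fin ℓ → ℤ := fun j k => D j k + if k < j then 1 else 0 with hE
  have hoff : (if i < i - 1 then 1 else 0 : ℤ) = offset i := by
    have hv := val_sub_one i
    have hi := i.isLt
    unfold offset
    by_cases h0 : i = 0
    · subst h0
      simp only [if_true] at hv ⊢
      rw [if_pos]
      rw [Fin.lt_def, hv]
      simp
      omega
    · have : (i : ℕ) ≠ 0 := fun h => h0 (Fin.ext (by simpa using h))
      simp only [h0, if_false] at hv ⊢
      rw [if_neg]
      rw [Fin.lt_def, hv]
      omega
  have hoff' : (if i - 1 < i then 1 else 0 : ℤ) = 1 - offset i := by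
    rw [← hoff]
    rcases lt_or_gt_of_ne hne with h | h
    · simp [h, h.le, not_lt.mpr]
    · simp [h, h.le, not_lt.mpr]
  have key : ∀ j k, (D' j k + if k < j then 1 else 0).toNat =
      (E (σ j) (σ k)).toNat + if j = i ∧ k = i - 1 then 1 else 0 := by
    intro j k
    have h3 := shift_add_lt hℓ i j k
    rw [← hσ] at h3
    have h4 : (D' j k + if k < j then 1 else 0) = E (σ j) (σ k)
        + (if j = i ∧ k = i - 1 then 1 else 0) - (if j = i - 1 ∧ k = i then 1 else 0) := by
      rw [hD, hE]
      simp only []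
      linarith
    rw [h4]
    by_cases hA : j = i ∧ k = i - 1
    · obtain ⟨rfl, rfl⟩ := hA
      have : E (σ j) (σ (j - 1)) = D (j - 1) j + offset j := by
        rw [hE, hσ, Equiv.swap_apply_left, Equiv.swap_apply_right]
        simp only []
        rw [hoff]
      rw [this]
      simp [hne.symm]
      omega
    · by_cases hB : j = i - 1 ∧ k = i
      · obtain ⟨rfl, rfl⟩ := hB
        have : E (σ (k - 1)) (σ k) = D k (k - 1) + (1 - offset k) := by
          rw [hE, hσ, Equiv.swap_apply_left, Equiv.swap_apply_right]
          simp only []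
          rw [hoff']
        rw [this]
        simp [hne]
        omega
      · simp [hA, hB]
  unfold positiveSum
  simp only [key, Finset.sum_add_distrib]
  congr 1
  · rw [Equiv.sum_comp σ (fun j => ∑ k, (E j (σ k)).toNat)]
    exact Finset.sum_congr rfl fun j _ => Equiv.sum_comp σ (fun k => (E j k).toNat)
  · rw [Finset.sum_eq_single i, Finset.sum_eq_single (i - 1)] <;> simp +contextual

/-! ### Elements of the affine symmetric group -/

/-- Every element is a lattice translation composed with a permutation of coordinates. -/
theorem exists_translation_permutation (g : affineSymmetricGroup ℓ) :
    ∃ (b : RootLattice ℓ) (σ : Equiv.Perm (Fin ℓ)),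
      ∀ (v : V ℓ) (j : Fin ℓ), ((g : V ℓ ≃ᵃ[ℝ] V ℓ) v).1 j = (b.1 j : ℝ) + v.1 (σ j) := by
  obtain ⟨g, hg⟩ := g
  simp only
  induction hg using Subgroup.closure_induction with
  | mem x hx =>
    obtain ⟨i, rfl⟩ := hx
    refine ⟨⟨shift i, ?_⟩, Equiv.swap (i - 1) i, fun v j => ?_⟩
    · unfold shift
      split_ifs <;> simp [Finset.sum_sub_distrib]
    · rw [simple_apply, add_comm]
  | one => exact ⟨⟨0, by simp⟩, 1, fun v j => by simp⟩
  | mul x y _ _ hx hy =>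
    obtain ⟨b, σ, hx⟩ := hx
    obtain ⟨c, τ, hy⟩ := hy
    refine ⟨⟨fun j => b.1 j + c.1 (σ j), ?_⟩, τ * σ, fun v j => ?_⟩
    · rw [Finset.sum_add_distrib, b.2, Equiv.sum_comp σ c.1, c.2, add_zero]
    · change (x (y v)).1 j = _
      rw [hx, hy]
      push_cast
      simp [add_assoc]
  | inv x _ hx =>
    obtain ⟨b, σ, hx⟩ := hx
    refine ⟨⟨fun j => - b.1 (σ.symm j), ?_⟩, σ.symm, fun v j => ?_⟩
    · rw [Finset.sum_neg_distrib, Equiv.sum_comp σ.symm b.1, b.2, neg_zero]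
    · have h := hx (x⁻¹ v) (σ.symm j)
      have h' : x (x⁻¹ v) = v := x.apply_symm_apply v
      rw [h', Equiv.apply_symm_apply] at h
      rw [h]
      push_cast
      ring

/-- The lattice part of an element is the image of the origin. -/
theorem exists_permutation_of_apply_zero {b : RootLattice ℓ} {g : affineSymmetricGroup ℓ}
    (hg : (g : V ℓ ≃ᵃ[ℝ] V ℓ) 0 = b.toV) :
    ∃ σ : Equiv.Perm (Fin ℓ),
      ∀ (v : V ℓ) (j : Fin ℓ), ((g : V ℓ ≃ᵃ[ℝ] V ℓ) v).1 j = (b.1 j : ℝ) + v.1 (σ j) := by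
  obtain ⟨c, σ, hc⟩ := exists_translation_permutation g
  refine ⟨σ, fun v j => ?_⟩
  have h1 := hc 0 j
  rw [hg] at h1
  have hcb : (c.1 j : ℝ) = b.1 j := by simpa [RootLattice.toV] using h1.symm
  rw [hc, hcb]

theorem apply_zero_of_mem_finite {u : V ℓ ≃ᵃ[ℝ] V ℓ}
    (hu : u ∈ finiteSymmetricGroup ℓ) : u 0 = 0 := by
  induction hu using Subgroup.closure_induction with
  | mem x hx =>
    obtain ⟨i, hi, rfl⟩ := hx
    ext j
    rw [simple_apply]
    have : i ≠ 0 := hi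
    simp [shift, this]
  | one => rfl
  | mul x y _ _ hx hy =>
    change x (y 0) = 0
    rw [hy, hx]
  | inv x _ hx =>
    have h' : x⁻¹ (x 0) = 0 := x.symm_apply_apply 0
    rwa [hx] at h'

theorem permuteCoords_mem_finite (σ : Equiv.Perm (Fin ℓ)) :
    (permuteCoords σ).toAffineEquiv ∈ finiteSymmetricGroup ℓ := by
  obtain ⟨n, rfl⟩ : ∃ n, ℓ = n + 1 := ⟨ℓ - 1, by have := NeZero.ne ℓ; omega⟩
  have h := Equiv.Perm.mclosure_swap_castSucc_succ n
  have hσ : σ ∈ Submonoid.closure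
      (Set.range fun i : Fin n => Equiv.swap i.castSucc i.succ) := by
    rw [h]; trivial
  induction hσ using Submonoid.closure_induction with
  | mem x hx =>
    obtain ⟨i, rfl⟩ := hx
    have h1 : (permuteCoords (Equiv.swap i.castSucc i.succ)).toAffineEquiv = simple i.succ := by
      ext v j
      rw [simple_apply]
      have : i.succ - 1 = i.castSucc := by
        apply Fin.ext
        rw [val_sub_one]
        simp
      rw [this]
      simp [shift]
      rfl
    rw [h1]
    exact Subgroup.subset_closure ⟨i.succ, Fin.succ_ne_zero i, rfl⟩
  | one =>
    have : (permuteCoords (1 : Equiv.Perm (Fin (n + 1)))).toAffineEquiv = 1 := rfl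
    rw [this]
    exact one_mem _
  | mul x y _ _ hx hy =>
    have : (permuteCoords (x * y)).toAffineEquiv
      = (permuteCoords y).toAffineEquiv * (permuteCoords x).toAffineEquiv := rfl
    rw [this]
    exact mul_mem hy hx

/-! ### Coxeter length as a number of separating hyperplanes -/

/-- A point of the fundamental alcove `v₀ > v₁ > ⋯ > v_{ℓ-1} > v₀ - 1`, with coordinates
`c - j / ℓ`; the constant `c` makes their sum zero. -/
noncomputable def basePoint (ℓ : ℕ) [NeZero ℓ] : V ℓ :=
  ⟨fun j => (∑ k : Fin ℓ, (k : ℝ) / ℓ) / ℓ - (j : ℝ) / ℓ, by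
    have : (ℓ : ℝ) ≠ 0 := by exact_mod_cast NeZero.ne ℓ
    change ∑ j, _ = _
    rw [Finset.sum_sub_distrib]
    simp
    field_simp
    simp⟩

theorem basePoint_sub (j k : Fin ℓ) :
    (basePoint ℓ).1 j - (basePoint ℓ).1 k = ((k : ℝ) - j) / ℓ := by
  simp only [basePoint]
  ring

theorem basePoint_sub_lt (j k : Fin ℓ) : (basePoint ℓ).1 j - (basePoint ℓ).1 k < 1 := by
  have hpos : (0 : ℝ) < ℓ := by exact_mod_cast Nat.pos_of_ne_zero (NeZero.ne ℓ)
  rw [basePoint_sub, div_lt_one hpos]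
  have h1 : ((k : ℕ) : ℝ) < ℓ := by exact_mod_cast k.isLt
  have h2 : (0 : ℝ) ≤ ((j : ℕ) : ℝ) := by positivity
  linarith

/-- The coordinates of the image of `basePoint` under `g`, a point of the alcove of `g`. -/
noncomputable def baseImage (g : affineSymmetricGroup ℓ) : Fin ℓ → ℝ :=
  ((g : V ℓ ≃ᵃ[ℝ] V ℓ) (basePoint ℓ)).1

theorem baseImage_simpleGen_mul (i : Fin ℓ) (g : affineSymmetricGroup ℓ) (j : Fin ℓ) :
    baseImage (simpleGen i * g) j
      = baseImage g (Equiv.swap (i - 1) i j) + (shift i j : ℝ) :=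
  simple_apply i _ j

/-- The point `baseImage g` lies on no affine root hyperplane. -/
theorem baseImage_sub_ne_int (g : affineSymmetricGroup ℓ) {j k : Fin ℓ} (hjk : j ≠ k) (m : ℤ) :
    baseImage g j - baseImage g k ≠ m := by
  obtain ⟨b, σ, h⟩ := exists_translation_permutation g
  intro h1
  have h2 := basePoint_sub (σ j) (σ k)
  have hpos : (0 : ℝ) < ℓ := by exact_mod_cast Nat.pos_of_ne_zero (NeZero.ne ℓ)
  unfold baseImage at h1
  rw [h, h] at h1
  rw [eq_div_iff hpos.ne'] at h2
  have h3 : ((m - b.1 j + b.1 k) * ℓ : ℝ) = ((σ k : ℕ) : ℝ) - (σ j : ℕ) := by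
    rw [← h2]; congr 1; linarith
  have h4 : ((m - b.1 j + b.1 k) * ℓ : ℤ) = ((σ k : ℕ) : ℤ) - (σ j : ℕ) := by exact_mod_cast h3
  have h5 : ((σ k : ℕ) : ℤ) - (σ j : ℕ) = 0 := by
    apply Int.eq_zero_of_abs_lt_dvd (m := (ℓ : ℤ))
    · exact ⟨m - b.1 j + b.1 k, by rw [← h4, mul_comm]⟩
    · have := (σ k).isLt
      have := (σ j).isLt
      rw [abs_lt]; omega
  exact hjk (σ.injective (Fin.ext (by omega)))

/-- The number of affine root hyperplanes separating `basePoint` from its image under `g`. For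
`k < j` the entries at `(j, k)` and `(k, j)` together count the integers `m` such that the
hyperplane `v_j - v_k = m` separates. -/
noncomputable def inversionCount (g : affineSymmetricGroup ℓ) : ℕ :=
  positiveSum fun j k => ⌊baseImage g j - baseImage g k⌋ + if k < j then 1 else 0

/-- The image of `basePoint` under `g` lies on the same side of the hyperplane of `s_i` as
`basePoint`; equivalently, `s_i g` is longer than `g`. -/
def Ascends (i : Fin ℓ) (g : affineSymmetricGroup ℓ) : Prop :=
  baseImage g i - offset i < baseImage g (i - 1)

theorem inversionCount_simpleGen_mul (hℓ : 2 ≤ ℓ) {i : Fin ℓ} {g : affineSymmetricGroup ℓ}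
    (h : Ascends i g) : inversionCount (simpleGen i * g) = inversionCount g + 1 := by
  unfold Ascends at h
  refine positiveSum_step hℓ i (fun j k => ?_) ?_ ?_
  · rw [baseImage_simpleGen_mul, baseImage_simpleGen_mul, ← Int.floor_add_intCast]
    congr 1
    push_cast
    ring
  · rw [← Int.floor_add_intCast, Int.floor_nonneg]
    linarith
  · have : ⌊baseImage g i - baseImage g (i - 1)⌋ < offset i := by
      rw [Int.floor_lt]
      linarith
    omega

theorem ascends_or_ascends (hℓ : 2 ≤ ℓ) (i : Fin ℓ) (g : affineSymmetricGroup ℓ) :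
    Ascends i g ∨ Ascends i (simpleGen i * g) := by
  unfold Ascends
  rw [baseImage_simpleGen_mul, baseImage_simpleGen_mul, shift_self hℓ, shift_sub_one hℓ,
    Equiv.swap_apply_left, Equiv.swap_apply_right]
  have h := baseImage_sub_ne_int g (sub_one_ne hℓ i).symm (offset i)
  push_cast
  rcases lt_or_gt_of_ne h with h | h
  · left; linarith
  · right; linarith

/-- The fundamental alcove is the only one on the positive side of all walls, and its stabilizer
is trivial. -/
theorem eq_one_of_forall_ascends (hℓ : 2 ≤ ℓ) {g : affineSymmetricGroup ℓ}
    (h : ∀ i, Ascends i g) : g = 1 := by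
  obtain ⟨b, σ, hg⟩ := exists_translation_permutation g
  have hpos : (0 : ℝ) < ℓ := by exact_mod_cast Nat.pos_of_ne_zero (NeZero.ne ℓ)
  -- The vector `ℓ (g p)`, up to a constant, has integer coordinates.
  set y : Fin ℓ → ℤ := fun j => ℓ * b.1 j - (σ j : ℕ) with hy
  have hstep : ∀ i, y i - ℓ * offset i < y (i - 1) := by
    intro i
    have h1 := h i
    have h2 := basePoint_sub (σ i) (σ (i - 1))
    rw [eq_div_iff hpos.ne'] at h2
    unfold Ascends baseImage at h1
    rw [hg, hg] at h1
    have h3 : (b.1 i + (basePoint ℓ).1 (σ i) - offset i) * ℓ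
        < ((b.1 (i - 1) : ℝ) + (basePoint ℓ).1 (σ (i - 1))) * ℓ :=
      mul_lt_mul_of_pos_right h1 hpos
    have h4 : ((ℓ * b.1 i - (σ i : ℕ) - ℓ * offset i : ℤ) : ℝ)
        < ((ℓ * b.1 (i - 1) - (σ (i - 1) : ℕ) : ℤ) : ℝ) := by
      push_cast
      linarith
    exact_mod_cast h4
  obtain ⟨n, rfl⟩ : ∃ n, ℓ = n + 1 := ⟨ℓ - 1, by omega⟩
  have hmono : ∀ i : Fin n, y i.succ + 1 ≤ y i.castSucc := by
    intro i
    have h1 := hstep i.succ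
    have : i.succ - 1 = i.castSucc := by
      apply Fin.ext
      rw [val_sub_one]
      simp
    rw [this] at h1
    simp [offset] at h1
    omega
  have hup : ∀ j : Fin (n + 1), y j + (j : ℕ) ≤ y 0 := by
    intro j
    induction j using Fin.induction with
    | zero => simp
    | succ i ih =>
      have := hmono i
      simp at ih ⊢
      omega
  -- The `ℓ` strictly decreasing values `y j` lie in a window of length `ℓ`, so they are consecutive.
  have hlast : y 0 ≤ y (Fin.last n) + n := by
    have h1 := hstep 0
    have : (0 : Fin (n + 1)) - 1 = Fin.last n := by
      apply Fin.ext
      rw [val_sub_one]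
      simp
    rw [this] at h1
    simp [offset] at h1
    omega
  have hdown : ∀ j : Fin (n + 1), y 0 ≤ y j + (j : ℕ) := by
    intro j
    induction j using Fin.reverseInduction with
    | last => simpa using hlast
    | cast i ih =>
      have := hmono i
      simp at ih ⊢
      omega
  have hyj : ∀ j, y j = y 0 - (j : ℕ) := fun j => by
    have := hup j
    have := hdown j
    omega
  have hsum : ∑ j, y j = - ∑ j : Fin (n + 1), ((j : ℕ) : ℤ) := by
    rw [hy, Finset.sum_sub_distrib, ← Finset.mul_sum, b.2,
      Equiv.sum_comp σ (fun j : Fin (n + 1) => ((j : ℕ) : ℤ))]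
    ring
  have hy0 : y 0 = 0 := by
    rw [Finset.sum_congr rfl fun j _ => hyj j, Finset.sum_sub_distrib] at hsum
    rw [Finset.sum_const, Finset.card_univ, Fintype.card_fin, nsmul_eq_mul] at hsum
    have h3 : ((n + 1 : ℕ) : ℤ) * y 0 = 0 := by linarith
    exact (mul_eq_zero.mp h3).resolve_left (by omega)
  have hz : ∀ j, b.1 j = 0 ∧ σ j = j := by
    intro j
    have h1 := hyj j
    rw [hy0, hy] at h1
    simp only [] at h1
    have h2 : ((σ j : ℕ) : ℤ) - (j : ℕ) = 0 := by
      apply Int.eq_zero_of_abs_lt_dvd (m := ((n + 1 : ℕ) : ℤ))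
      · exact ⟨b.1 j, by linarith⟩
      · have := (σ j).isLt
        have := j.isLt
        rw [abs_lt]; omega
    refine ⟨?_, Fin.ext (by omega)⟩
    have h3 : ((n + 1 : ℕ) : ℤ) * b.1 j = 0 := by linarith
    rcases mul_eq_zero.mp h3 with h | h
    · omega
    · exact h
  ext v j
  rw [hg, (hz j).1, (hz j).2]
  simp

theorem inversionCount_one : inversionCount (1 : affineSymmetricGroup ℓ) = 0 := by
  have hpos : (0 : ℝ) < ℓ := by exact_mod_cast Nat.pos_of_ne_zero (NeZero.ne ℓ)
  unfold inversionCount positiveSum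
  refine Finset.sum_eq_zero fun j _ => Finset.sum_eq_zero fun k _ => ?_
  have h : ∀ j, baseImage (1 : affineSymmetricGroup ℓ) j = (basePoint ℓ).1 j := fun j => rfl
  rw [Int.toNat_eq_zero]
  simp only [h]
  have h1 : ⌊(basePoint ℓ).1 j - (basePoint ℓ).1 k⌋ < 1 := by
    rw [Int.floor_lt]
    exact_mod_cast basePoint_sub_lt j k
  split_ifs with hkj
  · have : ⌊(basePoint ℓ).1 j - (basePoint ℓ).1 k⌋ < 0 := by
      rw [Int.floor_lt, basePoint_sub]
      have : ((k : ℕ) : ℝ) < (j : ℕ) := by exact_mod_cast hkj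
      simp only [Int.cast_zero]
      exact div_neg_of_neg_of_pos (by linarith) hpos
    omega
  · omega

theorem simpleGen_mul_cancel (i : Fin ℓ) (g : affineSymmetricGroup ℓ) :
    simpleGen i * (simpleGen i * g) = g := by
  rw [← mul_assoc, simpleGen_mul_self, one_mul]

theorem wordProd_cons (i : Fin ℓ) (ω : List (Fin ℓ)) :
    wordProd (i :: ω) = simpleGen i * wordProd ω := by
  simp [wordProd]

theorem inversionCount_wordProd_le (hℓ : 2 ≤ ℓ) (ω : List (Fin ℓ)) :
    inversionCount (wordProd ω) ≤ ω.length := by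
  induction ω with
  | nil => simp [wordProd, inversionCount_one]
  | cons i ω ih =>
    rw [wordProd_cons, List.length_cons]
    rcases ascends_or_ascends hℓ i (wordProd ω) with h | h
    · rw [inversionCount_simpleGen_mul hℓ h]
      omega
    · have := inversionCount_simpleGen_mul hℓ h
      rw [simpleGen_mul_cancel] at this
      omega

theorem exists_word_of_inversionCount (hℓ : 2 ≤ ℓ) (g : affineSymmetricGroup ℓ) :
    ∃ ω : List (Fin ℓ), ω.length = inversionCount g ∧ wordProd ω = g := by
  induction hn : inversionCount g using Nat.strong_induction_on generalizing g with
  | _ n ih =>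
    by_cases h : ∀ i, Ascends i g
    · have := eq_one_of_forall_ascends hℓ h
      subst this
      rw [inversionCount_one] at hn
      exact ⟨[], by simpa using hn, by simp [wordProd]⟩
    · push Not at h
      obtain ⟨i, hi⟩ := h
      have h1 := (ascends_or_ascends hℓ i g).resolve_left hi
      have h2 := inversionCount_simpleGen_mul hℓ h1
      rw [simpleGen_mul_cancel] at h2
      obtain ⟨ω, hω, hω'⟩ := ih _ (by omega) (simpleGen i * g) rfl
      exact ⟨i :: ω, by rw [List.length_cons]; omega,
        by rw [wordProd_cons, hω', simpleGen_mul_cancel]⟩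

theorem coxeterLength_eq_inversionCount (hℓ : 2 ≤ ℓ) (g : affineSymmetricGroup ℓ) :
    coxeterLength g = inversionCount g := by
  apply le_antisymm
  · exact Nat.sInf_le (exists_word_of_inversionCount hℓ g)
  · refine le_csInf ⟨_, exists_word_of_inversionCount hℓ g⟩ ?_
    rintro n ⟨ω, rfl, rfl⟩
    exact inversionCount_wordProd_le hℓ ω

theorem wordProd_reverse (ω : List (Fin ℓ)) : wordProd ω.reverse = (wordProd ω)⁻¹ := by
  induction ω with
  | nil => simp [wordProd]
  | cons i ω ih =>
    rw [wordProd_cons, mul_inv_rev, ← ih, inv_eq_of_mul_eq_one_right (simpleGen_mul_self i)]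
    simp [wordProd]

theorem coxeterLength_inv (g : affineSymmetricGroup ℓ) :
    coxeterLength g⁻¹ = coxeterLength g := by
  unfold coxeterLength
  congr 1
  ext n
  constructor
  · rintro ⟨ω, rfl, h⟩
    exact ⟨ω.reverse, by simp, by rw [wordProd_reverse, h, inv_inv]⟩
  · rintro ⟨ω, rfl, h⟩
    exact ⟨ω.reverse, by simp, by rw [wordProd_reverse, h]⟩

/-- A nontrivial element fixing the origin has a right descent `s_i` with `i ≠ 0`. -/
theorem exists_coxeterLength_mul_simpleGen_lt (hℓ : 2 ≤ ℓ) {u : affineSymmetricGroup ℓ}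
    (hu : (u : V ℓ ≃ᵃ[ℝ] V ℓ) 0 = 0) (hu1 : u ≠ 1) :
    ∃ i : Fin ℓ, i ≠ 0 ∧ coxeterLength (u * simpleGen i) < coxeterLength u := by
  have hex : ∃ i, ¬ Ascends i u⁻¹ := by
    by_contra! h
    exact hu1 (inv_eq_one.mp (eq_one_of_forall_ascends hℓ h))
  obtain ⟨i, hi⟩ := hex
  refine ⟨i, ?_, ?_⟩
  · rintro rfl
    -- A permutation of `basePoint` stays on the positive side of the hyperplane of `s_0`.
    apply hi
    have h2 : ((u⁻¹ : affineSymmetricGroup ℓ) : V ℓ ≃ᵃ[ℝ] V ℓ) 0 = 0 := by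
      have h' : (u : V ℓ ≃ᵃ[ℝ] V ℓ)⁻¹ ((u : V ℓ ≃ᵃ[ℝ] V ℓ) 0) = 0 :=
        (u : V ℓ ≃ᵃ[ℝ] V ℓ).symm_apply_apply 0
      rwa [hu] at h'
    have h3 : (0 : V ℓ) = RootLattice.toV ⟨0, by simp⟩ := by
      ext j
      simp [RootLattice.toV]
    obtain ⟨σ, h⟩ := exists_permutation_of_apply_zero (h2.trans h3)
    unfold Ascends baseImage
    rw [h, h]
    have := basePoint_sub_lt (σ 0) (σ (0 - 1))
    simp only [offset, if_true, Pi.zero_apply]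
    push_cast
    linarith
  · have h1 := (ascends_or_ascends hℓ i u⁻¹).resolve_left hi
    have h2 := inversionCount_simpleGen_mul hℓ h1
    rw [simpleGen_mul_cancel] at h2
    rw [← coxeterLength_inv u, ← coxeterLength_inv (u * simpleGen i), mul_inv_rev,
      inv_eq_of_mul_eq_one_right (simpleGen_mul_self i), coxeterLength_eq_inversionCount hℓ,
      coxeterLength_eq_inversionCount hℓ]
    omega

/-! ### Action on the root lattice -/

/-- The action of `s_i` on the root lattice. -/
def RootLattice.reflect (i : Fin ℓ) (b : RootLattice ℓ) : RootLattice ℓ :=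
  ⟨fun j => b.1 (Equiv.swap (i - 1) i j) + shift i j, by
    rw [Finset.sum_add_distrib, Equiv.sum_comp _ b.1, b.2, zero_add]
    unfold shift
    split_ifs <;> simp [Finset.sum_sub_distrib]⟩

theorem simple_toV (i : Fin ℓ) (b : RootLattice ℓ) :
    simple i b.toV = (b.reflect i).toV := by
  ext j
  rw [simple_apply]
  simp [RootLattice.toV, RootLattice.reflect]

theorem reflect_reflect (i : Fin ℓ) (b : RootLattice ℓ) : (b.reflect i).reflect i = b := by
  have h : ((b.reflect i).reflect i).toV = b.toV := by
    rw [← simple_toV, ← simple_toV]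
    exact congrArg (fun f : V ℓ ≃ᵃ[ℝ] V ℓ => f b.toV) (simple_mul_self i)
  apply Subtype.ext
  funext j
  have := congrFun (congrArg Subtype.val h) j
  simpa [RootLattice.toV] using this

/-- A strict ascent of the lattice point `g 0` is an ascent of `g`, since coordinates of
`basePoint` differ by less than one. -/
theorem ascends_of_lattice {i : Fin ℓ} {b : RootLattice ℓ} {g : affineSymmetricGroup ℓ}
    (hg : (g : V ℓ ≃ᵃ[ℝ] V ℓ) 0 = b.toV) (h : b.1 i - offset i < b.1 (i - 1)) :
    Ascends i g := by
  obtain ⟨σ, hσ⟩ := exists_permutation_of_apply_zero hg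
  unfold Ascends baseImage
  rw [hσ, hσ]
  have h1 := basePoint_sub_lt (σ i) (σ (i - 1))
  have h2 : (b.1 i : ℝ) - offset i + 1 ≤ b.1 (i - 1) := by exact_mod_cast h
  linarith

/-- The length of the minimal coset representative indexed by `b`: the entry at `(j, k)` is the
number of levels `n` such that position `n ℓ + k` of the flush abacus of `b` is a gap below the last
bead of runner `j`. -/
def latticeLength (b : RootLattice ℓ) : ℕ :=
  positiveSum fun j k => b.1 j - b.1 k - 1 + if k < j then 1 else 0

theorem latticeLength_reflect (hℓ : 2 ≤ ℓ) {i : Fin ℓ} {b : RootLattice ℓ}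
    (h : b.1 i - offset i < b.1 (i - 1)) :
    latticeLength (b.reflect i) = latticeLength b + 1 := by
  refine positiveSum_step hℓ i (fun j k => ?_) ?_ ?_
  · simp only [RootLattice.reflect]
    ring
  · omega
  · omega

/-- The cosets of the finite group are the fibres of `g ↦ g 0`. -/
theorem translation_inv_mul_mem {b : RootLattice ℓ} {g : affineSymmetricGroup ℓ}
    (hg : (g : V ℓ ≃ᵃ[ℝ] V ℓ) 0 = b.toV) :
    (translation b)⁻¹ * (g : V ℓ ≃ᵃ[ℝ] V ℓ) ∈ finiteSymmetricGroup ℓ := by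
  obtain ⟨σ, hσ⟩ := exists_permutation_of_apply_zero hg
  have : (g : V ℓ ≃ᵃ[ℝ] V ℓ) = translation b * (permuteCoords σ).toAffineEquiv := by
    ext v j
    rw [hσ]
    rfl
  rw [this, inv_mul_cancel_left]
  exact permuteCoords_mem_finite σ

/-! ### Runners of the abacus -/

/-- The runner of the abacus containing position `p`, which is `p` modulo `ℓ`. -/
def runner (ℓ : ℕ) [NeZero ℓ] (p : ℤ) : Fin ℓ :=
  ⟨(p % (ℓ : ℤ)).toNat, by
    have h0 : (ℓ : ℤ) ≠ 0 := by exact_mod_cast NeZero.ne ℓ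
    have h1 := Int.emod_nonneg p h0
    have h2 := Int.emod_lt_of_pos p (by have := Nat.pos_of_ne_zero (NeZero.ne ℓ); omega :
      (0 : ℤ) < ℓ)
    omega⟩

theorem residue_eq_runner (c : ℕ × ℕ) : residue ℓ c = runner ℓ ((c.2 : ℤ) - c.1) := rfl

theorem cast_pos_of_neZero : (0 : ℤ) < ℓ := by
  exact_mod_cast Nat.pos_of_ne_zero (NeZero.ne ℓ)

theorem ediv_mul_add_runner (p : ℤ) : p / ℓ * ℓ + (runner ℓ p : ℕ) = p := by
  have h1 := Int.emod_nonneg p (cast_pos_of_neZero (ℓ := ℓ)).ne'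
  have h2 := Int.mul_ediv_add_emod p ℓ
  have h3 : ((runner ℓ p : ℕ) : ℤ) = p % ℓ := by simp [runner, h1]
  rw [h3, mul_comm]
  exact h2

theorem mul_add_lt_mul_add_iff (A n : ℤ) (a j : Fin ℓ) :
    A * ℓ + (a : ℕ) < n * ℓ + (j : ℕ) ↔ A - (if a < j then 1 else 0) < n := by
  have ha := a.isLt
  have hj := j.isLt
  have hpos := cast_pos_of_neZero (ℓ := ℓ)
  rcases lt_trichotomy A n with h | rfl | h
  · have : (A + 1) * ℓ ≤ n * ℓ := mul_le_mul_of_nonneg_right h hpos.le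
    rw [add_mul, one_mul] at this
    constructor
    · intro _; split_ifs <;> omega
    · intro _; omega
  · simp only [Fin.lt_def]
    split_ifs <;> omega
  · have : (n + 1) * ℓ ≤ A * ℓ := mul_le_mul_of_nonneg_right h hpos.le
    rw [add_mul, one_mul] at this
    constructor
    · intro _; omega
    · split_ifs <;> omega

theorem mul_add_inj {A n : ℤ} {a j : Fin ℓ} (h : A * ℓ + (a : ℕ) = n * ℓ + (j : ℕ)) :
    A = n ∧ a = j := by
  have h1 := (mul_add_lt_mul_add_iff A n a j).not.mp (by omega)
  have h2 := (mul_add_lt_mul_add_iff n A j a).not.mp (by omega)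
  have hA : A = n := by
    split_ifs at h1 h2 <;> omega
  subst hA
  exact ⟨rfl, Fin.ext (by omega)⟩

theorem runner_mul_add (n : ℤ) (j : Fin ℓ) : runner ℓ (n * ℓ + (j : ℕ)) = j :=
  (mul_add_inj (ediv_mul_add_runner (n * ℓ + (j : ℕ)))).2

theorem runner_add_self (p : ℤ) : runner ℓ (p + ℓ) = runner ℓ p := by
  have h := ediv_mul_add_runner (ℓ := ℓ) p
  have h' : p + ℓ = (p / ℓ + 1) * ℓ + (runner ℓ p : ℕ) := by
    rw [add_mul, one_mul]; omega
  rw [h', runner_mul_add]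

theorem cast_val_sub_one (i : Fin ℓ) :
    (((i - 1 : Fin ℓ) : ℕ) : ℤ) = (i : ℕ) - 1 + ℓ * offset i := by
  have h := val_sub_one i
  have hpos := cast_pos_of_neZero (ℓ := ℓ)
  unfold offset
  by_cases h0 : i = 0
  · subst h0
    simp only [if_true] at h ⊢
    rw [h]
    simp
    omega
  · have : (i : ℕ) ≠ 0 := fun h => h0 (Fin.ext (by simpa using h))
    simp only [h0, if_false] at h ⊢
    omega

theorem runner_sub_one (p : ℤ) : runner ℓ (p - 1) = runner ℓ p - 1 := by
  have h := ediv_mul_add_runner (ℓ := ℓ) p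
  have h1 := cast_val_sub_one (runner ℓ p)
  have h' : p - 1 = (p / ℓ - offset (runner ℓ p)) * ℓ + ((runner ℓ p - 1 : Fin ℓ) : ℕ) := by
    rw [h1]
    linarith
  rw [h', runner_mul_add]

/-- The position of the last bead on runner `j` of the flush abacus given by `b`. -/
def topBead (b : Fin ℓ → ℤ) (j : Fin ℓ) : ℤ := b j * ℓ + (j : ℕ)

theorem le_topBead_iff (b : Fin ℓ → ℤ) (n : ℤ) (j : Fin ℓ) :
    n * ℓ + (j : ℕ) ≤ topBead b j ↔ n ≤ b j := by
  unfold topBead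
  rw [add_le_add_iff_right, mul_le_mul_iff_left₀ cast_pos_of_neZero]

theorem runner_topBead (b : Fin ℓ → ℤ) (j : Fin ℓ) : runner ℓ (topBead b j) = j :=
  runner_mul_add _ _

theorem mem_flushAbacus (b : RootLattice ℓ) (p : ℤ) :
    p ∈ flushAbacus b ↔ p ≤ topBead b.1 (runner ℓ p) := by
  constructor
  · rintro ⟨j, n, hn, rfl⟩
    rwa [runner_mul_add, le_topBead_iff]
  · intro h
    rw [← ediv_mul_add_runner (ℓ := ℓ) p, runner_mul_add, le_topBead_iff] at h
    exact ⟨_, _, h, (ediv_mul_add_runner p).symm⟩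

theorem descent_iff_topBead (b : Fin ℓ → ℤ) (i : Fin ℓ) :
    b (i - 1) < b i - offset i ↔ topBead b (i - 1) < topBead b i - 1 := by
  have hpos := cast_pos_of_neZero (ℓ := ℓ)
  unfold topBead
  rw [cast_val_sub_one, ← mul_lt_mul_iff_left₀ hpos, sub_mul]
  constructor <;> intro h <;> linarith

theorem shift_of_ne {i j : Fin ℓ} (h : j ≠ i) (h' : j ≠ i - 1) : shift i j = 0 := by
  unfold shift
  split_ifs <;> simp_all

theorem topBead_reflect_self (hℓ : 2 ≤ ℓ) (b : RootLattice ℓ) (i : Fin ℓ) :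
    topBead (b.reflect i).1 i = topBead b.1 (i - 1) + 1 := by
  simp only [topBead, RootLattice.reflect, Equiv.swap_apply_right, shift_self hℓ,
    cast_val_sub_one]
  ring

theorem topBead_reflect_sub_one (hℓ : 2 ≤ ℓ) (b : RootLattice ℓ) (i : Fin ℓ) :
    topBead (b.reflect i).1 (i - 1) = topBead b.1 i - 1 := by
  simp only [topBead, RootLattice.reflect, Equiv.swap_apply_left, shift_sub_one hℓ,
    cast_val_sub_one]
  ring

theorem topBead_reflect_of_ne (b : RootLattice ℓ) {i j : Fin ℓ} (h : j ≠ i) (h' : j ≠ i - 1) :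
    topBead (b.reflect i).1 j = topBead b.1 j := by
  simp only [topBead, RootLattice.reflect, Equiv.swap_apply_of_ne_of_ne h' h, shift_of_ne h h',
    add_zero]

/-! ### Counting beads -/

/-- The index of the bead in position `A ℓ + a` is the number of later beads, counted runner by
runner. -/
theorem index_eq_sum {f : ℕ → ℤ} (hf : StrictAnti f) {b : Fin ℓ → ℤ}
    (hb : ∀ p, (∃ r, f r = p) ↔ p ≤ topBead b (runner ℓ p)) {r : ℕ} {A : ℤ} {a : Fin ℓ}
    (hr : f r = A * ℓ + (a : ℕ)) :
    r = ∑ j, (b j - A + if a < j then 1 else 0).toNat := by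
  have hcard : (Finset.univ.sigma fun j : Fin ℓ =>
      Finset.Ioc (A - if a < j then 1 else 0) (b j)).card = ((Finset.range r).image f).card := by
    refine Finset.card_bij (fun x _ => x.2 * ℓ + (x.1 : ℕ)) ?_ ?_ ?_
    · rintro ⟨j, n⟩ hx
      simp only [Finset.mem_sigma, Finset.mem_univ, true_and, Finset.mem_Ioc] at hx
      have h1 := (hb (n * ℓ + (j : ℕ))).mpr (by rw [runner_mul_add, le_topBead_iff]; exact hx.2)
      obtain ⟨s, hs⟩ := h1
      have h2 := (mul_add_lt_mul_add_iff A n a j).mpr hx.1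
      rw [← hr, ← hs, hf.lt_iff_gt] at h2
      exact Finset.mem_image.mpr ⟨s, Finset.mem_range.mpr h2, hs⟩
    · rintro ⟨j, n⟩ _ ⟨j', n'⟩ _ h
      obtain ⟨h1, h2⟩ := mul_add_inj h
      simp only at h1 h2
      subst h1 h2
      rfl
    · intro p hp
      obtain ⟨s, hs, rfl⟩ := Finset.mem_image.mp hp
      have h1 := (hb (f s)).mp ⟨s, rfl⟩
      have h2 := ediv_mul_add_runner (ℓ := ℓ) (f s)
      refine ⟨⟨runner ℓ (f s), f s / ℓ⟩, ?_, h2⟩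
      simp only [Finset.mem_sigma, Finset.mem_univ, true_and, Finset.mem_Ioc]
      rw [← mul_add_lt_mul_add_iff, ← le_topBead_iff, h2, ← hr, hf.lt_iff_gt]
      exact ⟨Finset.mem_range.mp hs, h1⟩
  rw [Finset.card_image_of_injective _ hf.injective, Finset.card_range, Finset.card_sigma]
    at hcard
  rw [← hcard]
  refine Finset.sum_congr rfl fun j _ => ?_
  rw [Int.card_Ioc]
  congr 1
  ring

theorem sum_ite_lt {n : ℕ} (a : Fin n) :
    ∑ j : Fin n, (if a < j then 1 else 0 : ℤ) = n - 1 - (a : ℕ) := by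
  rw [Finset.sum_boole]
  have : (Finset.univ.filter fun j : Fin n => a < j) = Finset.Ioi a := by ext; simp
  rw [this, Fin.card_Ioi]
  have := a.isLt
  omega

theorem strictAnti_rowLen_sub (μ : YoungDiagram) (c : ℤ) :
    StrictAnti fun r : ℕ => (μ.rowLen r : ℤ) - r + c := by
  refine strictAnti_nat_of_succ_lt fun r => ?_
  have := μ.rowLen_anti r (r + 1) (by omega)
  push_cast
  omega

theorem rowLen_eq_zero_iff (μ : YoungDiagram) (r : ℕ) : μ.rowLen r = 0 ↔ μ.colLen 0 ≤ r := by
  rw [← not_iff_not, ← Ne, ← Nat.pos_iff_ne_zero, not_le, ← YoungDiagram.mem_iff_lt_rowLen,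
    YoungDiagram.mem_iff_lt_colLen]

/-- The shift of an abacus is determined by the number of beads. It is read off from a bead so far
to the left that all positions to its left are beads. -/
theorem charge_eq (μ : YoungDiagram) (c : ℤ) (b : Fin ℓ → ℤ)
    (hb : ∀ p, (∃ r : ℕ, (μ.rowLen r : ℤ) - r + c = p) ↔ p ≤ topBead b (runner ℓ p)) :
    c = ∑ j, b j + ℓ - 1 := by
  set r := μ.colLen 0 + ∑ j, (c - b j * ℓ).natAbs with hr
  have h0 : μ.rowLen r = 0 := (rowLen_eq_zero_iff μ r).mpr (by omega)
  set p : ℤ := (μ.rowLen r : ℤ) - r + c with hp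
  have hdiv := ediv_mul_add_runner (ℓ := ℓ) p
  have h1 := index_eq_sum (strictAnti_rowLen_sub μ c) hb (r := r) (A := p / ℓ)
    (a := runner ℓ p) hdiv.symm
  have hle : ∀ j, p / ℓ ≤ b j := by
    intro j
    have h2 : (c - b j * ℓ).natAbs ≤ ∑ j, (c - b j * ℓ).natAbs :=
      Finset.single_le_sum (f := fun j => (c - b j * ℓ).natAbs) (fun _ _ => Nat.zero_le _)
        (Finset.mem_univ j)
    have h3 : p ≤ b j * ℓ := by omega
    exact Int.ediv_le_of_le_mul cast_pos_of_neZero h3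
  have h2 : (r : ℤ) = ∑ j, (b j - p / ℓ + if runner ℓ p < j then 1 else 0) := by
    rw [h1]
    push_cast
    refine Finset.sum_congr rfl fun j _ => ?_
    have := hle j
    split_ifs <;> omega
  rw [Finset.sum_add_distrib, Finset.sum_sub_distrib, sum_ite_lt] at h2
  simp only [Finset.sum_const, Finset.card_univ, Fintype.card_fin, nsmul_eq_mul] at h2
  rw [h0] at hp
  push_cast at hp
  linarith

/-! ### Hook lengths and beads -/

theorem hookLength_add (μ : YoungDiagram) {r c : ℕ} (h : (r, c) ∈ μ) :
    hookLength μ (r, c) + r + c + 1 = μ.rowLen r + μ.colLen c := by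
  have h1 := YoungDiagram.mem_iff_lt_rowLen.mp h
  have h2 := YoungDiagram.mem_iff_lt_colLen.mp h
  have : (μ.cells.filter fun d => (d.1 = r ∧ c ≤ d.2) ∨ (d.2 = c ∧ r ≤ d.1)) =
      ({r} ×ˢ Finset.Ico c (μ.rowLen r)) ∪ (Finset.Ico (r + 1) (μ.colLen c) ×ˢ {c}) := by
    ext ⟨x, y⟩
    simp only [Finset.mem_filter, YoungDiagram.mem_cells, Finset.mem_union, Finset.mem_product,
      Finset.mem_singleton, Finset.mem_Ico]
    constructor
    · rintro ⟨hm, ⟨rfl, hy⟩ | ⟨rfl, hx⟩⟩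
      · exact Or.inl ⟨rfl, hy, YoungDiagram.mem_iff_lt_rowLen.mp hm⟩
      · rcases hx.eq_or_lt with rfl | hx
        · exact Or.inl ⟨rfl, le_rfl, h1⟩
        · exact Or.inr ⟨⟨hx, YoungDiagram.mem_iff_lt_colLen.mp hm⟩, rfl⟩
    · rintro (⟨rfl, hy, hm⟩ | ⟨⟨hx, hm⟩, rfl⟩)
      · exact ⟨YoungDiagram.mem_iff_lt_rowLen.mpr hm, Or.inl ⟨rfl, hy⟩⟩
      · exact ⟨YoungDiagram.mem_iff_lt_colLen.mpr hm, Or.inr ⟨rfl, by omega⟩⟩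
  unfold hookLength
  rw [this, Finset.card_union_of_disjoint, Finset.card_product, Finset.card_product]
  · simp
    omega
  · rw [Finset.disjoint_left]
    rintro ⟨x, y⟩ hx hy
    simp only [Finset.mem_product, Finset.mem_singleton, Finset.mem_Ico] at hx hy
    omega

theorem betaNumber_eq (μ : YoungDiagram) (r : ℕ) :
    betaNumber μ r = (μ.rowLen r : ℤ) - r + (μ.colLen 0 - 1) := by
  unfold betaNumber
  split_ifs with h
  · have := hookLength_add μ (YoungDiagram.mem_iff_lt_colLen.mpr h)
    omega
  · rw [(rowLen_eq_zero_iff μ r).mpr (by omega)]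
    push_cast
    ring

/-- The position of the bead of row `r` in the balanced abacus of `μ`. All `r : ℕ` are allowed:
rows of length `0` give the beads with no gap below them. -/
def rowBead (ℓ : ℕ) (μ : YoungDiagram) (r : ℕ) : ℤ := (μ.rowLen r : ℤ) - r + (ℓ - 1)

theorem rowBead_strictAnti {n : ℕ} (μ : YoungDiagram) : StrictAnti (rowBead n μ) :=
  strictAnti_rowLen_sub μ _

theorem corresponds_iff (b : RootLattice ℓ) (μ : YoungDiagram) :
    Corresponds b μ ↔ ∀ p, (∃ r, rowBead ℓ μ r = p) ↔ p ≤ topBead b.1 (runner ℓ p) := by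
  simp only [← mem_flushAbacus]
  constructor
  · rintro ⟨c, hc⟩
    have h1 : ∀ p, (∃ r : ℕ, (μ.rowLen r : ℤ) - r + (μ.colLen 0 - 1 + c) = p)
        ↔ p ∈ flushAbacus b := by
      intro p
      rw [hc]
      simp only [betaNumber_eq, Set.mem_range, add_assoc]
    have h2 := charge_eq μ _ b.1 (fun p => (h1 p).trans (mem_flushAbacus b p))
    intro p
    rw [← h1 p, h2, b.2, zero_add]
    rfl
  · intro h
    refine ⟨(ℓ - 1) - (μ.colLen 0 - 1), ?_⟩
    ext p
    rw [← h p]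
    simp only [Set.mem_range]
    refine exists_congr fun r => ?_
    rw [betaNumber_eq, rowBead]
    constructor <;> intro h <;> linarith

theorem Corresponds.unique {b b' : RootLattice ℓ} {μ : YoungDiagram} (h : Corresponds b μ)
    (h' : Corresponds b' μ) : b = b' := by
  rw [corresponds_iff] at h h'
  apply Subtype.ext
  funext j
  have h1 := (h (topBead b.1 j)).symm.trans (h' _)
  have h2 := (h (topBead b'.1 j)).symm.trans (h' _)
  rw [runner_topBead] at h1 h2
  have h3 := h1.mp le_rfl
  have h4 := h2.mpr le_rfl
  unfold topBead at h3 h4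
  rw [add_le_add_iff_right, mul_le_mul_iff_left₀ cast_pos_of_neZero] at h3 h4
  exact le_antisymm h3 h4

/-! ### Abaci of cores are flush -/

/-- Each gap `q` below the bead of row `r` is the gap of a column meeting row `r`, and the hook
length of their common box is the distance from the gap to the bead. -/
theorem exists_hookLength_eq_of_gap {n : ℕ} {μ : YoungDiagram} {r : ℕ} {q : ℤ}
    (hq : ∀ s, rowBead n μ s ≠ q) (hlt : q < rowBead n μ r) :
    ∃ c, (r, c) ∈ μ ∧ (hookLength μ (r, c) : ℤ) = rowBead n μ r - q := by
  have hanti := rowBead_strictAnti (n := n) μ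
  have hex : ∃ k, rowBead n μ k < q := by
    refine ⟨μ.colLen 0 + (n - q).natAbs, ?_⟩
    have h0 := (rowLen_eq_zero_iff μ (μ.colLen 0 + (n - q).natAbs)).mpr (by omega)
    unfold rowBead
    rw [h0]
    omega
  classical
  set k := Nat.find hex with hk
  have hk1 : rowBead n μ k < q := Nat.find_spec hex
  have hrk : r < k := hanti.lt_iff_gt.mp (hk1.trans hlt)
  have hk2 : q < rowBead n μ (k - 1) :=
    lt_of_le_of_ne (not_lt.mp (Nat.find_min hex (by omega))) (hq _).symm
  have hanti' := μ.rowLen_anti r (k - 1) (by omega)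
  unfold rowBead at hk1 hk2
  obtain ⟨c, hc⟩ : ∃ c : ℕ, (c : ℤ) = q + k - n := ⟨(q + k - n).toNat, by omega⟩
  have hc1 : (k - 1, c) ∈ μ := YoungDiagram.mem_iff_lt_rowLen.mpr (by omega)
  have hc2 : (k, c) ∉ μ := fun h => by
    have := YoungDiagram.mem_iff_lt_rowLen.mp h
    omega
  -- Rows `k - 1` and `k` surround the gap, and `c` is the column that ends between them.
  have hcol : μ.colLen c = k := by
    rw [YoungDiagram.mem_iff_lt_colLen] at hc1 hc2
    omega
  have hrc : (r, c) ∈ μ := μ.up_left_mem (by omega) le_rfl hc1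
  refine ⟨c, hrc, ?_⟩
  have := hookLength_add μ hrc
  unfold rowBead
  omega

theorem exists_rowBead_eq_of_le {n : ℕ} {μ : YoungDiagram} {p : ℤ}
    (hp : p ≤ n - 1 - μ.colLen 0) : ∃ r, rowBead n μ r = p := by
  refine ⟨(n - 1 - p).toNat, ?_⟩
  have h0 := (rowLen_eq_zero_iff μ (n - 1 - p).toNat).mpr (by omega)
  unfold rowBead
  rw [h0]
  push_cast
  omega

theorem IsCore.exists_corresponds {μ : YoungDiagram} (hμ : IsCore ℓ μ) :
    ∃ b : RootLattice ℓ, Corresponds b μ := by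
  have hpos := cast_pos_of_neZero (ℓ := ℓ)
  have hdown : ∀ p, (∃ r, rowBead ℓ μ r = p) → ∃ r, rowBead ℓ μ r = p - ℓ := by
    rintro p ⟨r, rfl⟩
    by_contra! h
    obtain ⟨c, hc, hc'⟩ := exists_hookLength_eq_of_gap h (by omega : _ < rowBead ℓ μ r)
    refine hμ _ hc ?_
    rw [show hookLength μ (r, c) = ℓ by omega]
  have hex : ∀ j : Fin ℓ, ∃ n : ℤ, (∃ r, rowBead ℓ μ r = n * ℓ + (j : ℕ)) ∧
      ∀ m : ℤ, (∃ r, rowBead ℓ μ r = m * ℓ + (j : ℕ)) → m ≤ n := by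
    intro j
    refine Int.exists_greatest_of_bdd ⟨(rowBead ℓ μ 0).natAbs, ?_⟩ ⟨-(μ.colLen 0) - 1, ?_⟩
    · rintro m ⟨r, hr⟩
      have h1 := (rowBead_strictAnti (n := ℓ) μ).antitone (Nat.zero_le r)
      by_contra! hm
      have : m * 1 ≤ m * ℓ := mul_le_mul_of_nonneg_left (by omega) (by omega)
      omega
    · apply exists_rowBead_eq_of_le
      have h1 : (μ.colLen 0 : ℤ) * 1 ≤ μ.colLen 0 * ℓ :=
        mul_le_mul_of_nonneg_left (by omega) (by omega)
      have := j.isLt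
      rw [sub_mul, neg_mul, one_mul]
      omega
  choose b hb hb' using hex
  have hiff : ∀ p, (∃ r, rowBead ℓ μ r = p) ↔ p ≤ topBead b (runner ℓ p) := by
    intro p
    have h2 := ediv_mul_add_runner (ℓ := ℓ) p
    constructor
    · intro h
      rw [← h2] at h
      have := hb' _ _ h
      rwa [← le_topBead_iff, h2] at this
    · intro h
      rw [← h2, runner_mul_add, le_topBead_iff] at h
      have h3 : ∀ m : ℕ, ∃ r, rowBead ℓ μ r =
          (b (runner ℓ p) - m) * ℓ + (runner ℓ p : ℕ) := by
        intro m
        induction m with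
        | zero => simpa using hb (runner ℓ p)
        | succ m ih =>
          obtain ⟨r, hr⟩ := hdown _ ih
          exact ⟨r, by rw [hr]; push_cast; ring⟩
      obtain ⟨r, hr⟩ := h3 (b (runner ℓ p) - p / ℓ).toNat
      refine ⟨r, ?_⟩
      rw [hr, Int.toNat_of_nonneg (by omega), sub_sub_cancel, h2]
  have hc := charge_eq μ _ b hiff
  exact ⟨⟨b, by linarith⟩, (corresponds_iff _ _).mpr hiff⟩

theorem corresponds_bot : Corresponds (⟨0, by simp⟩ : RootLattice ℓ) ⊥ := by
  obtain ⟨b, hb⟩ := IsCore.exists_corresponds (ℓ := ℓ) (μ := ⊥) (fun c hc => by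
    simp at hc)
  have hb' := (corresponds_iff _ _).mp hb
  have hrow : ∀ r, (⊥ : YoungDiagram).rowLen r = 0 := fun r => by
    by_contra h
    exact YoungDiagram.notMem_bot (r, 0)
      (YoungDiagram.mem_iff_lt_rowLen.mpr (Nat.pos_of_ne_zero h))
  have h0 : ∀ j, b.1 j ≤ 0 := by
    intro j
    obtain ⟨r, hr⟩ := (hb' (topBead b.1 j)).mpr (by rw [runner_topBead])
    unfold rowBead topBead at hr
    rw [hrow] at hr
    by_contra! h
    have h1 : 1 * (ℓ : ℤ) ≤ b.1 j * ℓ :=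
      mul_le_mul_of_nonneg_right h (cast_pos_of_neZero (ℓ := ℓ)).le
    omega
  have h1 := (Finset.sum_eq_zero_iff_of_nonpos fun j _ => h0 j).mp b.2
  have : b = ⟨0, by simp⟩ := Subtype.ext (funext fun j => h1 j (Finset.mem_univ j))
  rwa [this] at hb

/-! ### Row lengths as numbers of gaps -/

theorem runner_rowBead {μ : YoungDiagram} {r : ℕ} (hr : 0 < μ.rowLen r) :
    residue ℓ (lastBox μ r) = runner ℓ (rowBead ℓ μ r) := by
  rw [residue_eq_runner, ← runner_add_self]
  congr 1
  unfold lastBox rowBead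
  simp only
  omega

theorem rowLen_pos_iff (μ : YoungDiagram) (r : ℕ) : 0 < μ.rowLen r ↔ r < μ.colLen 0 := by
  rw [Nat.pos_iff_ne_zero, Ne, rowLen_eq_zero_iff, not_le]

/-- The longest row with last residue `i` belongs to the last bead on runner `i`. If there is no
such row, that bead belongs to a row of length `0`. -/
theorem longestRowLen_eq {μ : YoungDiagram} {b : RootLattice ℓ} (hb : Corresponds b μ)
    {i : Fin ℓ} {r : ℕ} (hr : rowBead ℓ μ r = topBead b.1 i) :
    longestRowLen ℓ μ i = μ.rowLen r := by
  rw [corresponds_iff] at hb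
  apply le_antisymm
  · refine Finset.sup_le fun s hs => ?_
    rw [Finset.mem_filter, Finset.mem_range] at hs
    have h1 := hs.2
    rw [runner_rowBead ((rowLen_pos_iff μ s).mpr hs.1)] at h1
    have h2 := (hb (rowBead ℓ μ s)).mp ⟨s, rfl⟩
    rw [h1, ← hr, (rowBead_strictAnti μ).le_iff_ge] at h2
    exact μ.rowLen_anti _ _ h2
  · by_cases h : r < μ.colLen 0
    · refine Finset.le_sup (f := μ.rowLen) ?_
      rw [Finset.mem_filter, Finset.mem_range]
      refine ⟨h, ?_⟩
      rw [runner_rowBead ((rowLen_pos_iff μ r).mpr h), hr, runner_topBead]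
    · rw [(rowLen_eq_zero_iff μ r).mpr (by omega)]
      exact Nat.zero_le _

theorem sum_longestRowLen {μ : YoungDiagram} {b : RootLattice ℓ} (hb : Corresponds b μ) :
    ∑ i, longestRowLen ℓ μ i = latticeLength b := by
  unfold latticeLength positiveSum
  refine Finset.sum_congr rfl fun i _ => ?_
  have hb' := (corresponds_iff _ _).mp hb
  obtain ⟨r, hr⟩ := (hb' (topBead b.1 i)).mpr (by rw [runner_topBead])
  rw [longestRowLen_eq hb hr]
  -- The later beads number `r`; as `∑ j, b j = 0`, this determines the number of earlier gaps.
  have h1 := index_eq_sum (rowBead_strictAnti μ) hb' hr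
  have h2 : ∀ j, ((b.1 i - b.1 j - 1 + if j < i then 1 else 0).toNat : ℤ)
      = (b.1 j - b.1 i + if i < j then 1 else 0).toNat
        + (b.1 i - b.1 j - if i < j then 1 else 0) := by
    intro j
    rcases lt_trichotomy i j with h | rfl | h
    · simp only [h, h.not_gt, if_true, if_false]
      omega
    · simp
    · simp only [h, h.not_gt, if_true, if_false]
      omega
  have h3 : (μ.rowLen r : ℤ) = ((∑ j, (b.1 i - b.1 j - 1 + if j < i then 1 else 0).toNat : ℕ) : ℤ)
      := by
    rw [Nat.cast_sum, Finset.sum_congr rfl fun j _ => h2 j, Finset.sum_add_distrib,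
      ← Nat.cast_sum, ← h1, Finset.sum_sub_distrib, Finset.sum_sub_distrib, sum_ite_lt, b.2]
    simp only [Finset.sum_const, Finset.card_univ, Fintype.card_fin, nsmul_eq_mul]
    unfold rowBead topBead at hr
    linarith
  exact_mod_cast h3

/-! ### Removing boxes -/

theorem isRemovable_iff (μ : YoungDiagram) (r c : ℕ) :
    IsRemovable μ (r, c) ↔ c + 1 = μ.rowLen r ∧ μ.rowLen (r + 1) < μ.rowLen r := by
  unfold IsRemovable
  simp only [YoungDiagram.mem_iff_lt_rowLen]
  omega

theorem mem_removeBoxes (i : Fin ℓ) (μ : YoungDiagram) (c : ℕ × ℕ) :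
    c ∈ removeBoxes i μ ↔ c ∈ μ ∧ ¬ (IsRemovable μ c ∧ residue ℓ c = i) := by
  classical
  rw [← YoungDiagram.mem_cells]
  unfold removeBoxes
  rw [Finset.mem_filter, YoungDiagram.mem_cells]

/-- Removing the boxes of residue `i` moves each bead on runner `i` whose left neighbour is a gap
into that gap. -/
theorem rowBead_removeBoxes (i : Fin ℓ) (μ : YoungDiagram) (r : ℕ) :
    rowBead ℓ (removeBoxes i μ) r =
      if rowBead ℓ μ (r + 1) ≠ rowBead ℓ μ r - 1 ∧ runner ℓ (rowBead ℓ μ r) = i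
      then rowBead ℓ μ r - 1 else rowBead ℓ μ r := by
  have hanti := μ.rowLen_anti r (r + 1) (by omega)
  have hiff : rowBead ℓ μ (r + 1) ≠ rowBead ℓ μ r - 1 ↔ μ.rowLen (r + 1) < μ.rowLen r := by
    unfold rowBead
    push_cast
    omega
  have hrow : (removeBoxes i μ).rowLen r =
      if μ.rowLen (r + 1) < μ.rowLen r ∧ runner ℓ (rowBead ℓ μ r) = i
      then μ.rowLen r - 1 else μ.rowLen r := by
    have h1 : ∀ c, c < (removeBoxes i μ).rowLen r ↔ c < μ.rowLen r ∧
        ¬ ((c + 1 = μ.rowLen r ∧ μ.rowLen (r + 1) < μ.rowLen r)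
          ∧ runner ℓ (rowBead ℓ μ r) = i) := by
      intro c
      rw [← YoungDiagram.mem_iff_lt_rowLen, mem_removeBoxes, isRemovable_iff,
        YoungDiagram.mem_iff_lt_rowLen]
      refine and_congr_right fun hc => not_congr (and_congr_right fun h => ?_)
      rw [← runner_rowBead (by omega), lastBox, ← h.1, Nat.add_sub_cancel]
    refine eq_of_forall_lt_iff fun c => ?_
    rw [h1]
    split_ifs with h
    · have := h.1
      simp only [h.2, h.1, and_true]
      omega
    · constructor
      · exact fun h => h.1
      · exact fun hc => ⟨hc, fun h' => h ⟨h'.1.2, h'.2⟩⟩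
  simp only [hiff]
  split_ifs with h <;> simp only [h, and_self, if_true, if_false] at hrow
  · have := h.1
    unfold rowBead
    omega
  · unfold rowBead
    omega

theorem exists_rowBead_sub_one_iff {n : ℕ} (μ : YoungDiagram) (r : ℕ) :
    (∃ s, rowBead n μ s = rowBead n μ r - 1) ↔ rowBead n μ (r + 1) = rowBead n μ r - 1 := by
  refine ⟨?_, fun h => ⟨_, h⟩⟩
  rintro ⟨s, hs⟩
  have hanti := rowBead_strictAnti (n := n) μ
  have h1 : r < s := hanti.lt_iff_gt.mp (by omega)
  have h2 := hanti.antitone (show r + 1 ≤ s by omega)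
  have h3 := hanti (show r < r + 1 by omega)
  omega

/-- At a descent, removing the boxes of residue `i` exchanges the contents of runners `i - 1` and
`i`, since no bead on runner `i - 1` is followed by a gap. -/
theorem corresponds_removeBoxes (hℓ : 2 ≤ ℓ) {b : RootLattice ℓ} {μ : YoungDiagram}
    (hb : Corresponds b μ) {i : Fin ℓ} (hi : b.1 (i - 1) < b.1 i - offset i) :
    Corresponds (b.reflect i) (removeBoxes i μ) := by
  have hne := sub_one_ne hℓ i
  rw [descent_iff_topBead] at hi
  rw [corresponds_iff] at hb ⊢
  have hself := topBead_reflect_self hℓ b i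
  have hsub := topBead_reflect_sub_one hℓ b i
  intro p
  simp only [rowBead_removeBoxes, Ne, ← exists_rowBead_sub_one_iff, hb]
  constructor
  · rintro ⟨r, hr⟩
    have hr' := (hb (rowBead ℓ μ r)).mp ⟨r, rfl⟩
    split_ifs at hr with h
    · rw [← hr, runner_sub_one, h.2, hsub]
      rw [h.2] at hr'
      omega
    · rw [hr] at h hr'
      by_cases h1 : runner ℓ p = i
      · have h2 : p - 1 ≤ topBead b.1 (runner ℓ (p - 1)) := by
          by_contra h2
          exact h ⟨h2, h1⟩
        rw [runner_sub_one, h1] at h2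
        rw [h1, hself]
        omega
      · by_cases h2 : runner ℓ p = i - 1
        · rw [h2] at hr' ⊢
          rw [hsub]
          omega
        · rwa [topBead_reflect_of_ne b h1 h2]
  · intro hp
    by_cases h1 : runner ℓ p = i
    · rw [h1, hself] at hp
      obtain ⟨r, hr⟩ := (hb p).mpr (by rw [h1]; omega)
      refine ⟨r, ?_⟩
      rw [hr, if_neg]
      rw [runner_sub_one, h1]
      intro h
      exact h.1 (by omega)
    · by_cases h2 : runner ℓ p = i - 1
      · rw [h2, hsub] at hp
        by_cases h3 : p ≤ topBead b.1 (i - 1)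
        · obtain ⟨r, hr⟩ := (hb p).mpr (by rwa [h2])
          refine ⟨r, ?_⟩
          rw [hr, if_neg]
          exact fun h => h1 h.2
        · have h4 : runner ℓ (p + 1) = i := by
            have h5 := runner_sub_one (ℓ := ℓ) (p + 1)
            rw [add_sub_cancel_right, h2] at h5
            exact (sub_left_injective h5).symm
          obtain ⟨r, hr⟩ := (hb (p + 1)).mpr (by rw [h4]; omega)
          refine ⟨r, ?_⟩
          rw [hr, add_sub_cancel_right, if_pos]
          exact ⟨by rwa [h2], h4⟩
      · rw [topBead_reflect_of_ne b h1 h2] at hp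
        obtain ⟨r, hr⟩ := (hb p).mpr hp
        refine ⟨r, ?_⟩
        rw [hr, if_neg]
        exact fun h => h1 h.2

theorem colLen_zero_pos {μ : YoungDiagram} (hμ : μ ≠ ⊥) : 0 < μ.colLen 0 := by
  by_contra! h
  apply hμ
  ext ⟨r, c⟩
  simp only [YoungDiagram.mem_cells, YoungDiagram.notMem_bot, iff_false]
  intro hm
  have h1 : (r, 0) ∈ μ := μ.up_left_mem le_rfl (Nat.zero_le c) hm
  have := YoungDiagram.mem_iff_lt_colLen.mp h1
  omega

theorem rowLen_bottom {μ : YoungDiagram} (hμ : μ ≠ ⊥) :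
    0 < μ.rowLen (μ.colLen 0 - 1) ∧ μ.rowLen (μ.colLen 0 - 1 + 1) = 0 := by
  have := colLen_zero_pos hμ
  exact ⟨(rowLen_pos_iff _ _).mpr (by omega), (rowLen_eq_zero_iff _ _).mpr (by omega)⟩

/-- The bead of the bottom row is the first one after a gap, so its left neighbour is a gap. -/
theorem bottomResidue_descent {b : RootLattice ℓ} {μ : YoungDiagram}
    (hb : Corresponds b μ) (hμ : μ ≠ ⊥) :
    b.1 (bottomResidue ℓ μ - 1) < b.1 (bottomResidue ℓ μ) - offset (bottomResidue ℓ μ) := by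
  obtain ⟨h1, h2⟩ := rowLen_bottom hμ
  rw [corresponds_iff] at hb
  have h3 : bottomResidue ℓ μ = runner ℓ (rowBead ℓ μ (μ.colLen 0 - 1)) := runner_rowBead h1
  have h4 := (hb _).mp ⟨μ.colLen 0 - 1, rfl⟩
  have h5 := (exists_rowBead_sub_one_iff (n := ℓ) μ (μ.colLen 0 - 1)).not.mpr (by
    unfold rowBead
    rw [h2]
    push_cast
    omega)
  rw [hb, runner_sub_one, ← h3] at h5
  rw [← h3] at h4
  rw [descent_iff_topBead]
  omega

theorem card_removeBoxes_bottomResidue_lt {μ : YoungDiagram} (hμ : μ ≠ ⊥) :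
    (removeBoxes (bottomResidue ℓ μ) μ).card < μ.card := by
  obtain ⟨h1, h2⟩ := rowLen_bottom hμ
  refine Finset.card_lt_card ((Finset.ssubset_iff_of_subset ?_).mpr
    ⟨lastBox μ (μ.colLen 0 - 1), ?_, ?_⟩)
  · intro c hc
    exact ((mem_removeBoxes _ _ _).mp hc).1
  · exact YoungDiagram.mem_iff_lt_rowLen.mpr (by omega)
  · intro hc
    refine ((mem_removeBoxes _ _ _).mp hc).2 ⟨?_, rfl⟩
    exact (isRemovable_iff _ _ _).mpr (by omega)

theorem applySimple_of_descent {b : RootLattice ℓ} {μ : YoungDiagram} (hb : Corresponds b μ)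
    {i : Fin ℓ} (hi : b.1 (i - 1) < b.1 i - offset i) : applySimple i μ = removeBoxes i μ := by
  unfold applySimple
  rw [if_neg, if_pos ⟨b, hb, hi⟩]
  rintro ⟨b', hb', h⟩
  rw [hb'.unique hb] at h
  exact lt_asymm hi h

/-! ### The canonical word -/

/-- The product of the canonical word sends the origin to `b`, and its length adds to that of every
element of the finite group: each letter is an ascent which depends only on the coset. -/
theorem canonicalWord_spec (hℓ : 2 ≤ ℓ) (μ : YoungDiagram) (b : RootLattice ℓ)
    (hb : Corresponds b μ) :
    ((wordProd (canonicalWord ℓ μ) : affineSymmetricGroup ℓ) : V ℓ ≃ᵃ[ℝ] V ℓ) 0 = b.toV ∧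
    (canonicalWord ℓ μ).length = latticeLength b ∧
    ∀ u : affineSymmetricGroup ℓ, (u : V ℓ ≃ᵃ[ℝ] V ℓ) 0 = 0 →
      coxeterLength (wordProd (canonicalWord ℓ μ) * u) =
        (canonicalWord ℓ μ).length + coxeterLength u := by
  induction hn : μ.card using Nat.strong_induction_on generalizing μ b with
  | _ n ih =>
    by_cases hμ : μ = ⊥
    · subst hμ
      have hw : canonicalWord ℓ ⊥ = [] := by
        rw [canonicalWord, if_pos rfl]
      rw [hb.unique corresponds_bot, hw]
      refine ⟨?_, ?_, ?_⟩
      · ext j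
        simp [wordProd, RootLattice.toV]
      · rw [List.length_nil, eq_comm]
        unfold latticeLength positiveSum
        refine Finset.sum_eq_zero fun j _ => Finset.sum_eq_zero fun k _ => ?_
        simp only [Pi.zero_apply]
        split_ifs <;> simp
      · intro u _
        simp [wordProd]
    · set i := bottomResidue ℓ μ with hi
      have hdesc := bottomResidue_descent hb hμ
      rw [← hi] at hdesc
      have happ := applySimple_of_descent hb hdesc
      have hcard := card_removeBoxes_bottomResidue_lt (ℓ := ℓ) hμ
      rw [← hi] at hcard
      have hw : canonicalWord ℓ μ = i :: canonicalWord ℓ (removeBoxes i μ) := by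
        rw [canonicalWord, if_neg hμ, ← hi, happ, if_pos hcard]
      have hb' := corresponds_removeBoxes hℓ hb hdesc
      have hasc : (b.reflect i).1 i - offset i < (b.reflect i).1 (i - 1) := by
        simp only [RootLattice.reflect, Equiv.swap_apply_left, Equiv.swap_apply_right,
          shift_self hℓ, shift_sub_one hℓ]
        omega
      obtain ⟨h1, h2, h3⟩ := ih _ (by omega) (removeBoxes i μ) (b.reflect i) hb' rfl
      rw [hw, wordProd_cons, List.length_cons]
      refine ⟨?_, ?_, ?_⟩
      · change simple i (((wordProd (canonicalWord ℓ (removeBoxes i μ)) :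
          affineSymmetricGroup ℓ) : V ℓ ≃ᵃ[ℝ] V ℓ) 0) = b.toV
        rw [h1, simple_toV, reflect_reflect]
      · have h4 := latticeLength_reflect hℓ hasc
        rw [reflect_reflect] at h4
        rw [h4, h2]
      · intro u hu
        have h4 : ((wordProd (canonicalWord ℓ (removeBoxes i μ)) * u : affineSymmetricGroup ℓ) :
            V ℓ ≃ᵃ[ℝ] V ℓ) 0 = (b.reflect i).toV := by
          rw [← h1]
          change ((wordProd (canonicalWord ℓ (removeBoxes i μ)) : affineSymmetricGroup ℓ) :
            V ℓ ≃ᵃ[ℝ] V ℓ) ((u : V ℓ ≃ᵃ[ℝ] V ℓ) 0) = _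
          rw [hu]
        have h5 := h3 u hu
        rw [coxeterLength_eq_inversionCount hℓ] at h5 ⊢
        rw [mul_assoc, inversionCount_simpleGen_mul hℓ (ascends_of_lattice h4 hasc), h5]
        omega

theorem coxeterLength_one (hℓ : 2 ≤ ℓ) : coxeterLength (1 : affineSymmetricGroup ℓ) = 0 := by
  rw [coxeterLength_eq_inversionCount hℓ, inversionCount_one]

theorem coxeterLength_simpleGen_pos (hℓ : 2 ≤ ℓ) (i : Fin ℓ) :
    0 < coxeterLength (simpleGen i : affineSymmetricGroup ℓ) := by
  rw [coxeterLength_eq_inversionCount hℓ]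
  rcases ascends_or_ascends hℓ i 1 with h | h
  · have := inversionCount_simpleGen_mul hℓ h
    rw [mul_one] at this
    omega
  · have := inversionCount_simpleGen_mul hℓ h
    rw [simpleGen_mul_cancel, inversionCount_one] at this
    omega

theorem simpleGen_zero {i : Fin ℓ} (hi : i ≠ 0) :
    ((simpleGen i : affineSymmetricGroup ℓ) : V ℓ ≃ᵃ[ℝ] V ℓ) 0 = 0 :=
  apply_zero_of_mem_finite (Subgroup.subset_closure ⟨i, hi, rfl⟩)

/-- A minimal representative is `w(μ) u` with `u` in the finite group; if `u ≠ 1`, a right descent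
of `u` would shorten it. -/
theorem isMinimalRepresentativeOf_iff (hℓ : 2 ≤ ℓ) {μ : YoungDiagram} {b : RootLattice ℓ}
    (hb : Corresponds b μ) (g : affineSymmetricGroup ℓ) :
    IsMinimalRepresentativeOf μ g ↔ g = wordProd (canonicalWord ℓ μ) := by
  obtain ⟨h1, h2, h3⟩ := canonicalWord_spec hℓ μ b hb
  set w : affineSymmetricGroup ℓ := wordProd (canonicalWord ℓ μ) with hw
  have hlen : coxeterLength w = (canonicalWord ℓ μ).length := by
    have := h3 1 rfl
    rwa [mul_one, coxeterLength_one hℓ, add_zero] at this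
  constructor
  · rintro ⟨b', hb', hmin, hmem⟩
    rw [hb'.unique hb] at hmem
    set u := w⁻¹ * g with hu
    have hg : g = w * u := by rw [hu, mul_inv_cancel_left]
    have hu0 : (u : V ℓ ≃ᵃ[ℝ] V ℓ) 0 = 0 := by
      apply apply_zero_of_mem_finite
      have h4 := mul_mem (inv_mem (translation_inv_mul_mem h1)) hmem
      rwa [mul_inv_rev, inv_inv, mul_assoc, mul_inv_cancel_left] at h4
    by_contra hne
    have hu1 : u ≠ 1 := fun h => hne (by rw [hg, h, mul_one])
    obtain ⟨i, hi, hlt⟩ := exists_coxeterLength_mul_simpleGen_lt hℓ hu0 hu1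
    have h5 := hmin i hi
    have h6 : ((u * simpleGen i : affineSymmetricGroup ℓ) : V ℓ ≃ᵃ[ℝ] V ℓ) 0 = 0 := by
      change (u : V ℓ ≃ᵃ[ℝ] V ℓ) (((simpleGen i : affineSymmetricGroup ℓ) : V ℓ ≃ᵃ[ℝ] V ℓ) 0) = 0
      rw [simpleGen_zero hi, hu0]
    rw [hg, mul_assoc, h3 _ hu0, h3 _ h6] at h5
    omega
  · rintro rfl
    refine ⟨b, hb, fun i hi => ?_, translation_inv_mul_mem h1⟩
    rw [h3 _ (simpleGen_zero hi), hlen]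
    have := coxeterLength_simpleGen_pos hℓ i
    omega

end AffineCore

theorem proposition3p3 (ℓ : ℕ) [NeZero ℓ] (hℓ : 2 ≤ ℓ) (μ : YoungDiagram)
    (hμ : AffineCore.IsCore ℓ μ) :
    (∃! g : AffineCore.affineSymmetricGroup ℓ, AffineCore.IsMinimalRepresentativeOf μ g) ∧
    (∀ g : AffineCore.affineSymmetricGroup ℓ, AffineCore.IsMinimalRepresentativeOf μ g →
      AffineCore.IsReducedExpression (AffineCore.canonicalWord ℓ μ) g) ∧
    AffineCore.coxeterLength (AffineCore.wordProd (AffineCore.canonicalWord ℓ μ)) =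
      ∑ i : Fin ℓ, AffineCore.longestRowLen ℓ μ i := by
  open AffineCore in
  obtain ⟨b, hb⟩ := hμ.exists_corresponds
  have hiff := isMinimalRepresentativeOf_iff hℓ hb
  obtain ⟨-, h2, h3⟩ := canonicalWord_spec hℓ μ b hb
  have hlen : coxeterLength (wordProd (canonicalWord ℓ μ)) = (canonicalWord ℓ μ).length := by
    have h := h3 1 rfl
    rwa [mul_one, coxeterLength_one hℓ, add_zero] at h
  refine ⟨⟨wordProd (canonicalWord ℓ μ), (hiff _).mpr rfl, fun g hg => (hiff g).mp hg⟩,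
    fun g hg => ?_, ?_⟩
  · rw [(hiff g).mp hg]
    exact ⟨rfl, hlen.symm⟩
  · rw [hlen, h2, sum_longestRowLen hb]
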